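/- **Setting.** Let $D\in\mathbb R^{N\times N}$ be a deterministic matrix (each column is a canonical basis vector; $n_j$ denotes the row of the unique $1$ in column $j$), with the states labelled so that $$D=\begin{bmatrix}P&D_{12}\\0&D_{22}\end{bmatrix},$$ where $P$ is the permutation matrix of a permutation $\sigma$ of the recurrent states $\widetilde{\mathcal X}=\{x_1,\dots,x_{N-r}\}$ ($Pu_x=u_{\sigma(x)}$) and $D_{22}\in\mathbb R^{r\times r}$ is nilpotent; the last $r$ states are the transient ones. Let $Q\in\mathbb R^{N\times N}$ satisfy $q_{ij}\ge 0$ for $i\ne n_j$ and $q_{n_jj}=-\sum_{i\neq n_j}q_{ij}$, and put $T_\varepsilon=D+\varepsilon Q$, which is column-stochastic for all small $\varepsilon>0$. Let $E\in\mathbb R^{S\times N}$ be column-stochastic and $\pi_0$ a probability vector. For every small $\varepsilon>0$ let $(\boldsymbol x^\star_k)_{k\ge0}$, $(\boldsymbol y_k)_{k\ge1}$ be a hidden Markov model with initial distribution $\pi_0$, transition probabilities $\mathbb P(\boldsymbol x^\star_{k+1}=x_i\mid \boldsymbol x^\star_k=x_j)=(T_\varepsilon)_{ij}$ and emission probabilities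 $\mathbb P(\boldsymbol y_k=u_i\mid\boldsymbol x^\star_k=x_j)=e_{ij}$, where $u_1,\dots,u_S$ are the canonical basis vectors of $\mathbb R^S$. Let $M$ be the order of $P$ and let $\widetilde E$ consist of the first $N-r$ columns of $E$. Assume that all entries of $\widetilde E$ are strictly positive and that no two columns of the stacked matrix $\widetilde E_s$ with blocks $\widetilde EP^0,\dots,\widetilde EP^{M-1}$ are identical. For $\delta\in(0,1)$ the adaptive logit filter is $$\boldsymbol w_k=\begin{bmatrix}P&0\\0&I_r\end{bmatrix}(1-\delta)\boldsymbol w_{k-1}+\delta\log(E^\top\boldsymbol y_k),\qquad w_0=\begin{bmatrix}\widetilde w_0\\-\infty\mathbb 1_r\end{bmatrix},$$ with $\widetilde w_0\in\mathbb R^{N-r}$ fixed and finite, elementwise logarithm, $\log 0=-\infty$ and $0\cdot(-\infty)=0$. Its decoding error is $p_k=\mathbb P[\arg\max_x\boldsymbol w_k(x)\ne\boldsymbol x_k^\star]$, where a tie at the maximum counts as an error. **Constants.** For distinct $x',x\in\widetilde{\mathcal X}$ and $0\le n<M$ let $\mathbb P(y\mid z)$ be the entry of $\widetilde E$ for observation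 $y$ and state $z$, let $g_n(y)=\log\frac{\mathbb P(y\mid\sigma^{-n}(x'))}{\mathbb P(y\mid\sigma^{-n}(x))}$, let $\Lambda_n(t;x',x)=\log\sum_y\mathbb P(y\mid\sigma^{-n}(x'))e^{tg_n(y)}$ and $d_n(x',x)=\sum_y\mathbb P(y\mid\sigma^{-n}(x'))g_n(y)$, and let $\Gamma(x',x)$ be the set of those $n$ for which $\mathbb P(\cdot\mid\sigma^{-n}(x))\neq\mathbb P(\cdot\mid\sigma^{-n}(x'))$. Put $$\rho(x',x)=\sum_{n\in\Gamma(x',x)}\int_0^{-1/M}\frac{\Lambda_n(\tau;x',x)}{\tau}\,d\tau,\qquad \xi=\min_{x\ne x'}\Big(-\frac1M\,\rho(x',x)\Big),$$ with $\xi=+\infty$ if there is only one recurrent state, and $W=\max\{\|\widetilde w_0\|_\infty,\max_y\|\log(\widetilde E^\top y)\|_\infty\}$, $q_{\min}=\min_jq_{n_jj}\le 0$. **Theorem.** 1. If $\delta=\delta_\varepsilon>0$ satisfies $\lim_{\varepsilon\to0}\delta_\varepsilon=0$ and $\lim_{\varepsilon\to0}\varepsilon/\delta_\varepsilon=0$,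 then $\lim_{\varepsilon\to0}\limsup_{k\to\infty}p_k=0$. 2. $\xi>0$. Let $\lambda\in(0,\xi)$ and $\delta_\varepsilon=\lambda/\log(1/\varepsilon)$. Then there is $\alpha>0$ with $$\rho(x',x)+\lambda M+e^{-\alpha}\Big(\sum_{n\in\Gamma(x',x)}\frac1M d_n(x',x)+2W\Big)<0\quad\text{for all distinct }x',x\in\widetilde{\mathcal X},$$ and for every such $\alpha$, with $\kappa=-q_{\min}\alpha/\lambda$ (which is positive if $Q\ne0$), $$\limsup_{k\to\infty}p_k\le\kappa\,\varepsilon\log\frac1\varepsilon+o\Big(\varepsilon\log\frac1\varepsilon\Big)\qquad(\varepsilon\to0^+).$$ -/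

import Mathlib

open Filter Topology MeasureTheory Matrix

noncomputable section

namespace ALF

/-- The state space: `m` recurrent states (left summand) and `r` transient states (right summand)
of the deterministic backbone. -/
abbrev State (m r : ℕ) : Type := Fin m ⊕ Fin r

/-- Every column is a canonical basis vector. -/
def IsDeterministic {X : Type*} [DecidableEq X] (D : Matrix X X ℝ) : Prop :=
  ∀ j, ∃ i, (fun a => D a j) = Pi.single i 1

/-- The constraint on the perturbation `Q`: off the row `n` holding the unique `1` of column `j` of
`D` the entries of `Q` are nonnegative, and in that row `Q` balances the column sum to zero. -/
def IsDrift {X : Type*} [Fintype X] [DecidableEq X] (D Q : Matrix X X ℝ) : Prop :=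
  ∀ j n, D n j = 1 → (∀ i, i ≠ n → 0 ≤ Q i j) ∧ Q n j = -∑ i ∈ Finset.univ.erase n, Q i j

/-- Nonnegative entries, every column sums to one. -/
def IsColumnStochastic {I J : Type*} [Fintype I] (A : Matrix I J ℝ) : Prop :=
  (∀ i j, 0 ≤ A i j) ∧ ∀ j, ∑ i, A i j = 1

/-- The permutation matrix with `P u_j = u_{σ j}`. -/
def permMat {m : ℕ} (σ : Equiv.Perm (Fin m)) : Matrix (Fin m) (Fin m) ℝ :=
  Matrix.of fun i j => if i = σ j then 1 else 0

/-- The order `M` of the permutation matrix: the least positive integer with `P ^ M = 1`. -/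
def permOrder {m : ℕ} (σ : Equiv.Perm (Fin m)) : ℕ := orderOf (permMat σ)

/-- The columns of the emission matrix at the recurrent states. -/
def recEmission {m r S : ℕ} (E : Matrix (Fin S) (State m r) ℝ) : Matrix (Fin S) (Fin m) ℝ :=
  Matrix.of fun s x => E s (Sum.inl x)

/-- The stacked matrix with blocks `F * P ^ 0, …, F * P ^ (M - 1)`. -/
def stacked {m S : ℕ} (σ : Equiv.Perm (Fin m)) (F : Matrix (Fin S) (Fin m) ℝ) :
    Matrix (Fin (permOrder σ) × Fin S) (Fin m) ℝ :=
  Matrix.of fun a x => (F * permMat σ ^ (a.1 : ℕ)) a.2 x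

/-- `X 0, X 1, …` and `Y 1, Y 2, …` form a hidden Markov model with initial distribution `π₀`,
transition matrix `T` (columns are the current state) and emission matrix `E`, given through the
joint law of `(X 0, …, X n, Y 1, …, Y n)`. The variable `Y 0` plays no role. -/
structure IsHMM {Ω : Type*} [MeasurableSpace Ω] (μ : Measure Ω) {m r S : ℕ}
    (X : ℕ → Ω → State m r) (Y : ℕ → Ω → Fin S) (π₀ : State m r → ℝ)
    (T : Matrix (State m r) (State m r) ℝ) (E : Matrix (Fin S) (State m r) ℝ) : Prop where
  prob : IsProbabilityMeasure μ
  meas_state : ∀ k, Measurable (X k)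
  meas_obs : ∀ k, Measurable (Y k)
  joint_law : ∀ (n : ℕ) (x : ℕ → State m r) (y : ℕ → Fin S),
    μ.real {ω | (∀ k ≤ n, X k ω = x k) ∧ ∀ k, 1 ≤ k → k ≤ n → Y k ω = y k}
      = π₀ (x 0) * ∏ k ∈ Finset.range n, T (x (k + 1)) (x k) * E (y (k + 1)) (x (k + 1))

/-- The initial vector: `w0` on the recurrent states, `-∞` on the transient ones. -/
def initLogit {m : ℕ} (r : ℕ) (w0 : Fin m → ℝ) : State m r → EReal :=
  Sum.elim (fun x => (w0 x : EReal)) fun _ => ⊥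

/-- One step of the filter,
`w ↦ diag(P, I_r) (1 - δ) w + δ log (Eᵀ y)`, with values in the extended reals, where
`0 * (-∞) = 0` and `log 0 = -∞`. The observation `s` enters as the basis vector `u_s`. -/
def alfStep {m r S : ℕ} (σ : Equiv.Perm (Fin m)) (E : Matrix (Fin S) (State m r) ℝ) (δ : ℝ)
    (w : State m r → EReal) (s : Fin S) : State m r → EReal := fun i =>
  (∑ j, ((Matrix.fromBlocks (permMat σ) 0 0 1 : Matrix (State m r) (State m r) ℝ) i j : EReal)
      * (((1 - δ : ℝ) : EReal) * w j))
    + (δ : EReal) * ENNReal.log (ENNReal.ofReal ((Eᵀ *ᵥ Pi.single s 1) i))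

/-- The filter driven by the observations `y 1, y 2, …`. -/
def alf {m r S : ℕ} (σ : Equiv.Perm (Fin m)) (E : Matrix (Fin S) (State m r) ℝ) (δ : ℝ)
    (w0 : Fin m → ℝ) (y : ℕ → Fin S) : ℕ → State m r → EReal
  | 0 => initLogit r w0
  | k + 1 => alfStep σ E δ (alf σ E δ w0 y k) (y (k + 1))

/-- The set of maximizers. -/
def argmax {X : Type*} (w : X → EReal) : Set X := {x | ∀ x', w x' ≤ w x}

/-- The state-decoding error `p_k`. A tie counts as an error, whatever the tie-breaking rule. -/
def errProb {Ω : Type*} [MeasurableSpace Ω] (μ : Measure Ω) {m r S : ℕ}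
    (X : ℕ → Ω → State m r) (Y : ℕ → Ω → Fin S) (σ : Equiv.Perm (Fin m))
    (E : Matrix (Fin S) (State m r) ℝ) (w0 : Fin m → ℝ) (δ : ℝ) (k : ℕ) : ℝ :=
  μ.real {ω | argmax (alf σ E δ w0 (fun i => Y i ω) k) ≠ {X k ω}}

/-- The log-likelihood ratio of the observation `s` between the states `σ^{-n} x'` and `σ^{-n} x`. -/
def logRatio {m S : ℕ} (σ : Equiv.Perm (Fin m)) (F : Matrix (Fin S) (Fin m) ℝ)
    (x' x : Fin m) (n : ℕ) (s : Fin S) : ℝ :=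
  Real.log (F s ((σ ^ (-(n : ℤ))) x') / F s ((σ ^ (-(n : ℤ))) x))

/-- `Λ_n(t)`: the logarithmic moment generating function of the log-likelihood ratio when the
observation is emitted from `σ^{-n} x'`. -/
def logMGF {m S : ℕ} (σ : Equiv.Perm (Fin m)) (F : Matrix (Fin S) (Fin m) ℝ)
    (x' x : Fin m) (n : ℕ) (t : ℝ) : ℝ :=
  Real.log (∑ s, F s ((σ ^ (-(n : ℤ))) x') * Real.exp (t * logRatio σ F x' x n s))

/-- `d_n`: the mean of the log-likelihood ratio, a Kullback–Leibler divergence. -/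
def klDiv {m S : ℕ} (σ : Equiv.Perm (Fin m)) (F : Matrix (Fin S) (Fin m) ℝ)
    (x' x : Fin m) (n : ℕ) : ℝ :=
  ∑ s, F s ((σ ^ (-(n : ℤ))) x') * logRatio σ F x' x n s

open Classical in
/-- The lags `n < M` at which the emission distributions from `x'` and `x` differ. -/
def lagSet {m S : ℕ} (σ : Equiv.Perm (Fin m)) (F : Matrix (Fin S) (Fin m) ℝ)
    (x' x : Fin m) : Finset ℕ :=
  (Finset.range (permOrder σ)).filter fun n =>
    ∃ s, F s ((σ ^ (-(n : ℤ))) x) ≠ F s ((σ ^ (-(n : ℤ))) x')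

/-- `∑_{n ∈ Γ} ∫_0^{-1/M} Λ_n(τ) / τ dτ`. -/
def rateIntegral {m S : ℕ} (σ : Equiv.Perm (Fin m)) (F : Matrix (Fin S) (Fin m) ℝ)
    (x' x : Fin m) : ℝ :=
  ∑ n ∈ lagSet σ F x' x, ∫ τ in (0 : ℝ)..(-(1 / (permOrder σ : ℝ))), logMGF σ F x' x n τ / τ

/-- The constant `ξ`: the minimum of `-(1/M) ∑_n ∫_0^{-1/M} Λ_n(τ) / τ dτ` over pairs of distinct
recurrent states (`+∞` if there is only one recurrent state). -/
def xi {m S : ℕ} (σ : Equiv.Perm (Fin m)) (F : Matrix (Fin S) (Fin m) ℝ) : EReal :=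
  ⨅ (x' : Fin m) (x : Fin m) (_ : x ≠ x'),
    ((-(1 / (permOrder σ : ℝ)) * rateIntegral σ F x' x : ℝ) : EReal)

/-- `W = max {‖w0‖_∞, max_y ‖log (Fᵀ y)‖_∞}`; norms of functions on finite sets are sup norms. -/
def logitBound {m S : ℕ} (F : Matrix (Fin S) (Fin m) ℝ) (w0 : Fin m → ℝ) : ℝ :=
  max ‖w0‖ ‖fun (s : Fin S) (x : Fin m) => Real.log (F s x)‖

/-- The window parameter `α > 0` is large enough for the rate `lam`. -/
def IsLargeWindow {m S : ℕ} (σ : Equiv.Perm (Fin m)) (F : Matrix (Fin S) (Fin m) ℝ)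
    (w0 : Fin m → ℝ) (lam α : ℝ) : Prop :=
  0 < α ∧ ∀ x' x : Fin m, x ≠ x' →
    rateIntegral σ F x' x + lam * permOrder σ
      + Real.exp (-α) * (∑ n ∈ lagSet σ F x' x, 1 / (permOrder σ : ℝ) * klDiv σ F x' x n
          + 2 * logitBound F w0) < 0

/-- `q_min = min_j q_{n_j j}`; for a deterministic `D` the inner sum is the entry `q_{n_j j}`. -/
def qMin {X : Type*} [Fintype X] (D Q : Matrix X X ℝ) : ℝ := ⨅ j, ∑ i, D i j * Q i j

/-- The constant `κ = -q_min α / lam`. -/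
def kappa {X : Type*} [Fintype X] (D Q : Matrix X X ℝ) (lam α : ℝ) : ℝ := -qMin D Q * α / lam

end ALF

end

/-!
Unless the chain leaves the deterministic backbone during the last `K ≈ α / δ` steps, which costs
at most `-q_min ε` per step, it runs along the recurrent cycles there, and the filter errs only if
a discounted sum of log-likelihood ratios over this window is at most of the order of
`(1 - δ) ^ K`. Chernoff's bound at `1 / M` controls the latter event: its exponent
`∑ Λ_n (-(1 - δ) ^ n / M)` is a Riemann sum, along the geometric grid `(1 - δ) ^ n / M`, of
`∫ Λ_n(τ) / τ dτ`, with relative mesh of order `M δ` on each of the `M` classes of `n`. Convexity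
of `Λ_n` makes `Λ_n(τ) / τ` monotone, so that the comparison with the integral is one-sided, and
the tail below the window is at most `e ^ (-α)` times the mean log-likelihood ratio. Hence the
confusion probability is `O (exp (-lam / δ))`.
-/


namespace ALF

section CumulantGeneratingFunction

variable {ι : Type*} [Fintype ι] {p q g : ι → ℝ}

/-- The cumulant generating function (logarithmic moment generating function) of `g` under the
weights `p` on a finite type. -/
noncomputable def cgf (p g : ι → ℝ) (t : ℝ) : ℝ := Real.log (∑ s, p s * Real.exp (t * g s))

lemma sum_mul_exp_pos (hp : p ∈ stdSimplex ℝ ι) (t : ℝ) : 0 < ∑ s, p s * Real.exp (t * g s) := by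
  have hnonneg (s : ι) : 0 ≤ p s * Real.exp (t * g s) := mul_nonneg (hp.1 s) (Real.exp_pos _).le
  obtain ⟨s, -, hs⟩ : ∃ s ∈ Finset.univ, 0 < p s :=
    Finset.exists_lt_of_sum_lt (by rw [Finset.sum_const_zero, hp.2]; exact one_pos)
  exact Finset.sum_pos' (fun s _ => hnonneg s)
    ⟨s, Finset.mem_univ _, mul_pos hs (Real.exp_pos _)⟩

lemma exp_cgf (hp : p ∈ stdSimplex ℝ ι) (t : ℝ) :
    Real.exp (cgf p g t) = ∑ s, p s * Real.exp (t * g s) :=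
  Real.exp_log (sum_mul_exp_pos hp t)

lemma continuous_cgf (hp : p ∈ stdSimplex ℝ ι) : Continuous (cgf p g) :=
  Continuous.log (by fun_prop) fun t => (sum_mul_exp_pos hp t).ne'

lemma mul_mean_le_cgf (hp : p ∈ stdSimplex ℝ ι) (t : ℝ) : t * ∑ s, p s * g s ≤ cgf p g t := by
  rw [cgf, Real.le_log_iff_exp_le (sum_mul_exp_pos hp t)]
  have jensen := convexOn_exp.map_sum_le (t := Finset.univ) (p := fun s => t * g s)
    (fun s _ => hp.1 s) hp.2 fun s _ => Set.mem_univ _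
  simpa only [smul_eq_mul, Finset.mul_sum, mul_left_comm t] using jensen

/-- This is the monotonicity of the weighted power means of `exp (g s)` in their exponent. -/
lemma monotoneOn_cgf_div (hp : p ∈ stdSimplex ℝ ι) :
    MonotoneOn (fun t => cgf p g t / t) (Set.Iio 0) := by
  intro t (ht : t < 0) u (hu : u < 0) htu
  have ht0 := ht.ne
  have hu0 := hu.ne
  have powerMean : (∑ s, p s * Real.exp (u * g s)) ^ (t / u)
      ≤ ∑ s, p s * Real.exp (u * g s) ^ (t / u) :=
    Real.rpow_arith_mean_le_arith_mean_rpow Finset.univ p _ (fun s _ => hp.1 s) hp.2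
      (fun s _ => (Real.exp_pos _).le) ((one_le_div_of_neg hu).2 htu)
  have hmul : t / u * cgf p g u ≤ cgf p g t := by
    rw [cgf, ← Real.log_rpow (sum_mul_exp_pos hp u)]
    refine Real.log_le_log (Real.rpow_pos_of_pos (sum_mul_exp_pos hp u) _)
      (powerMean.trans_eq (Finset.sum_congr rfl fun s _ => ?_))
    rw [← Real.exp_mul]
    congr 2
    field_simp
  calc cgf p g t / t ≤ t / u * cgf p g u / t := div_le_div_of_nonpos_of_le ht.le hmul
    _ = cgf p g u / u := by field_simp

lemma mul_exp_mul_log_div {a b : ℝ} (ha : 0 < a) (hb : 0 < b) (t : ℝ) :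
    a * Real.exp (t * Real.log (a / b))
      = Real.exp ((1 + t) * Real.log a + -t * Real.log b) := by
  rw [Real.log_div ha.ne' hb.ne']
  nth_rw 1 [← Real.exp_log ha]
  rw [← Real.exp_add]
  ring_nf

lemma mul_exp_mul_log_div_le {a b t : ℝ} (ha : 0 < a) (hb : 0 < b) (ht : -1 ≤ t) (ht0 : t ≤ 0) :
    a * Real.exp (t * Real.log (a / b)) ≤ (1 + t) * a + -t * b := by
  have h := convexOn_exp.2 (Set.mem_univ (Real.log a)) (Set.mem_univ (Real.log b))
    (by linarith : 0 ≤ 1 + t) (by linarith : 0 ≤ -t) (by ring)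
  simpa only [mul_exp_mul_log_div ha hb, smul_eq_mul, Real.exp_log ha, Real.exp_log hb] using h

lemma mul_exp_mul_log_div_lt {a b t : ℝ} (ha : 0 < a) (hb : 0 < b) (hab : a ≠ b)
    (ht : -1 < t) (ht0 : t < 0) :
    a * Real.exp (t * Real.log (a / b)) < (1 + t) * a + -t * b := by
  have h := strictConvexOn_exp.2 (Set.mem_univ (Real.log a)) (Set.mem_univ (Real.log b))
    (fun h => hab (Real.log_injOn_pos ha hb h)) (by linarith : 0 < 1 + t)
    (by linarith : 0 < -t) (by ring)
  simpa only [mul_exp_mul_log_div ha hb, smul_eq_mul, Real.exp_log ha, Real.exp_log hb] using h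

lemma sum_affine_combination (hp : p ∈ stdSimplex ℝ ι) (hq : q ∈ stdSimplex ℝ ι) (t : ℝ) :
    ∑ s, ((1 + t) * p s + -t * q s) = 1 := by
  rw [Finset.sum_add_distrib, ← Finset.mul_sum, ← Finset.mul_sum, hp.2, hq.2]
  ring

lemma cgf_log_div_nonpos (hp : p ∈ stdSimplex ℝ ι) (hq : q ∈ stdSimplex ℝ ι)
    (hp0 : ∀ s, 0 < p s) (hq0 : ∀ s, 0 < q s) {t : ℝ} (ht : -1 ≤ t) (ht0 : t ≤ 0) :
    cgf p (fun s => Real.log (p s / q s)) t ≤ 0 := by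
  refine Real.log_nonpos (sum_mul_exp_pos hp t).le ?_
  rw [← sum_affine_combination hp hq t]
  exact Finset.sum_le_sum fun s _ => mul_exp_mul_log_div_le (hp0 s) (hq0 s) ht ht0

lemma cgf_log_div_neg (hp : p ∈ stdSimplex ℝ ι) (hq : q ∈ stdSimplex ℝ ι)
    (hp0 : ∀ s, 0 < p s) (hq0 : ∀ s, 0 < q s) (hpq : p ≠ q) {t : ℝ} (ht : -1 < t) (ht0 : t < 0) :
    cgf p (fun s => Real.log (p s / q s)) t < 0 := by
  refine Real.log_neg (sum_mul_exp_pos hp t) ?_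
  rw [← sum_affine_combination hp hq t]
  obtain ⟨s, hs⟩ := Function.ne_iff.1 hpq
  exact Finset.sum_lt_sum
    (fun s _ => mul_exp_mul_log_div_le (hp0 s) (hq0 s) ht.le ht0.le)
    ⟨s, Finset.mem_univ _, mul_exp_mul_log_div_lt (hp0 s) (hq0 s) hs ht ht0⟩

end CumulantGeneratingFunction

section MonotoneRiemannSum

lemma sum_range_add_sub {G : Type*} [AddCommGroup G] (a : ℕ → G) (K M : ℕ) :
    ∑ n ∈ Finset.range K, (a (n + M) - a n) = ∑ n ∈ Finset.range M, (a (K + n) - a n) := by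
  have h := (Finset.sum_range_add a K M).symm.trans
    ((congrArg (fun k => ∑ n ∈ Finset.range k, a n) (add_comm K M)).trans
      (Finset.sum_range_add a M K))
  simp only [Finset.sum_sub_distrib, sub_eq_sub_iff_add_eq_add, add_comm _ M]
  rw [add_comm, ← h, add_comm]

lemma sum_range_add_of_periodic {G : Type*} [AddCommGroup G] {c : ℕ → G} {M : ℕ}
    (hc : Function.Periodic c M) (K : ℕ) :
    ∑ n ∈ Finset.range M, c (K + n) = ∑ n ∈ Finset.range M, c n := by
  rw [← sub_eq_zero, ← Finset.sum_sub_distrib, ← sum_range_add_sub]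
  exact Finset.sum_eq_zero fun n _ => sub_eq_zero.2 (hc n)

/-- The integrals `∫ h n` over the grid cells `[v n, v (n + M)]` telescope along each residue class
modulo the period `M`. -/
lemma sum_integral_le_sum_of_monotoneOn_of_periodic {h : ℕ → ℝ → ℝ} {v : ℕ → ℝ} {s : Set ℝ}
    {M : ℕ} (hper : Function.Periodic h M) (hs : s.OrdConnected)
    (hmono : ∀ n, MonotoneOn (h n) s) (hvs : ∀ n, v n ∈ s) (hv : ∀ n, v n ≤ v (n + M))
    (hv0 : ∀ n < M, v n = v 0) (K : ℕ) :
    ∑ n ∈ Finset.range M, ∫ τ in v 0..v (K + n), h (K + n) τ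
      ≤ ∑ n ∈ Finset.range K, (v (n + M) - v n) * h n (v (n + M)) := by
  have hint (n i j : ℕ) : IntervalIntegrable (h n) volume (v i) (v j) :=
    ((hmono n).mono (hs.uIcc_subset (hvs i) (hvs j))).intervalIntegrable
  have hcell (n : ℕ) : ∫ τ in v n..v (n + M), h n τ ≤ (v (n + M) - v n) * h n (v (n + M)) := by
    have hle : ∀ τ ∈ Set.Icc (v n) (v (n + M)), h n τ ≤ h n (v (n + M)) := fun τ hτ =>
      hmono n (hs.out (hvs _) (hvs _) hτ) (hvs _) hτ.2
    simpa using intervalIntegral.integral_mono_on (hv n) (hint n _ _) intervalIntegrable_const hle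
  calc ∑ n ∈ Finset.range M, ∫ τ in v 0..v (K + n), h (K + n) τ
      = ∑ n ∈ Finset.range M,
          ((∫ τ in v 0..v (K + n), h (K + n) τ) - ∫ τ in v 0..v n, h n τ) := by
        refine Finset.sum_congr rfl fun n hn => ?_
        rw [hv0 n (Finset.mem_range.1 hn), intervalIntegral.integral_same, sub_zero]
    _ = ∑ n ∈ Finset.range K,
          ((∫ τ in v 0..v (n + M), h (n + M) τ) - ∫ τ in v 0..v n, h n τ) :=
        (sum_range_add_sub (fun n => ∫ τ in v 0..v n, h n τ) K M).symm
    _ = ∑ n ∈ Finset.range K, ∫ τ in v n..v (n + M), h n τ :=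
        Finset.sum_congr rfl fun n _ => by
          rw [hper n, intervalIntegral.integral_interval_sub_left (hint n _ _) (hint n _ _)]
    _ ≤ ∑ n ∈ Finset.range K, (v (n + M) - v n) * h n (v (n + M)) :=
        Finset.sum_le_sum fun n _ => hcell n

end MonotoneRiemannSum

section Permutation

variable {m S : ℕ}

lemma mul_permMat_pow_apply (F : Matrix (Fin S) (Fin m) ℝ) (σ : Equiv.Perm (Fin m)) (n : ℕ)
    (s : Fin S) (x : Fin m) : (F * permMat σ ^ n) s x = F s ((σ ^ n) x) := by
  induction n generalizing x with
  | zero => simp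
  | succ n ih =>
    have hcol (i : Fin m) : permMat σ i x = if i = σ x then 1 else 0 := rfl
    rw [pow_succ, ← Matrix.mul_assoc, Matrix.mul_apply]
    simp [hcol, ih, pow_succ]

lemma permMat_pow_eq_one_iff (σ : Equiv.Perm (Fin m)) (n : ℕ) : permMat σ ^ n = 1 ↔ σ ^ n = 1 := by
  have hentry (i j : Fin m) :
      (permMat σ ^ n) i j = (1 : Matrix (Fin m) (Fin m) ℝ) i ((σ ^ n) j) := by
    simpa using mul_permMat_pow_apply 1 σ n i j
  refine ⟨fun h => Equiv.ext fun j => ?_, fun h => ?_⟩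
  · by_contra (hne : (σ ^ n) j ≠ j)
    have h1 := hentry ((σ ^ n) j) j
    rw [h, Matrix.one_apply_eq, Matrix.one_apply_ne hne] at h1
    exact zero_ne_one h1
  · ext i j
    rw [hentry, h, Equiv.Perm.one_apply]

lemma permOrder_eq_orderOf (σ : Equiv.Perm (Fin m)) : permOrder σ = orderOf σ :=
  orderOf_eq_orderOf_iff.2 (permMat_pow_eq_one_iff σ)

lemma permOrder_pos (σ : Equiv.Perm (Fin m)) : 0 < permOrder σ := by
  rw [permOrder_eq_orderOf]
  exact orderOf_pos σ

lemma pow_permOrder (σ : Equiv.Perm (Fin m)) : σ ^ permOrder σ = 1 := by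
  rw [permOrder_eq_orderOf, pow_orderOf_eq_one]

lemma periodic_zpow_neg (σ : Equiv.Perm (Fin m)) :
    Function.Periodic (fun n : ℕ => σ ^ (-(n : ℤ))) (permOrder σ) := by
  intro n
  simp only [_root_.zpow_neg, zpow_natCast, pow_add, pow_permOrder, mul_one]

lemma stacked_apply (σ : Equiv.Perm (Fin m)) (F : Matrix (Fin S) (Fin m) ℝ)
    (a : Fin (permOrder σ) × Fin S) (x : Fin m) :
    stacked σ F a x = F a.2 ((σ ^ (a.1 : ℕ)) x) :=
  mul_permMat_pow_apply F σ a.1 a.2 x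

end Permutation

lemma lt_iInf_of_finite {α : Type*} {ι : Sort*} [CompleteLinearOrder α] [Finite ι] {a : α}
    {f : ι → α} (ha : a < ⊤) (hf : ∀ i, a < f i) : a < ⨅ i, f i := by
  cases nonempty_fintype (PLift ι)
  rw [← iInf_plift_down, ← Finset.inf_univ_eq_iInf, Finset.lt_inf_iff ha]
  exact fun i _ => hf i.down

section Rate

variable {m S : ℕ} {σ : Equiv.Perm (Fin m)} {F : Matrix (Fin S) (Fin m) ℝ} {x' x : Fin m}

lemma abs_log_le_logitBound (w0 : Fin m → ℝ) (s : Fin S) (x : Fin m) :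
    |Real.log (F s x)| ≤ logitBound F w0 :=
  ((norm_le_pi_norm (fun x => Real.log (F s x)) x).trans
    (norm_le_pi_norm (fun s x => Real.log (F s x)) s)).trans (le_max_right _ _)

lemma abs_init_le_logitBound (w0 : Fin m → ℝ) (x : Fin m) : |w0 x| ≤ logitBound F w0 :=
  (norm_le_pi_norm w0 x).trans (le_max_left _ _)

lemma logitBound_nonneg (w0 : Fin m → ℝ) : 0 ≤ logitBound F w0 :=
  (norm_nonneg _).trans (le_max_left _ _)

lemma periodic_logMGF : Function.Periodic (logMGF σ F x' x) (permOrder σ) := fun n => by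
  have h := periodic_zpow_neg σ n
  simp only at h
  simp only [funext_iff, logMGF, logRatio, h, implies_true]

lemma periodic_klDiv : Function.Periodic (klDiv σ F x' x) (permOrder σ) := fun n => by
  have h := periodic_zpow_neg σ n
  simp only at h
  simp only [klDiv, logRatio, h]

lemma neg_inv_permOrder_mem_Ico : -(1 / (permOrder σ : ℝ)) ∈ Set.Ico (-1 : ℝ) 0 := by
  have hM : (1 : ℝ) ≤ permOrder σ := by exact_mod_cast permOrder_pos σ
  exact ⟨neg_le_neg ((div_le_one (by linarith)).2 hM), neg_lt_zero.2 (by positivity)⟩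

lemma lagSet_subset_range : lagSet σ F x' x ⊆ Finset.range (permOrder σ) :=
  Finset.filter_subset _ _

lemma lagSet_nonempty (h : ∃ a, stacked σ F a x ≠ stacked σ F a x') :
    (lagSet σ F x' x).Nonempty := by
  classical
  obtain ⟨⟨a, s⟩, h⟩ := h
  rw [stacked_apply, stacked_apply] at h
  have hlag : σ ^ (-(((permOrder σ - a) % permOrder σ : ℕ) : ℤ)) = σ ^ (a : ℕ) := by
    rw [_root_.zpow_neg, zpow_natCast, inv_eq_iff_mul_eq_one,
      ← pow_eq_pow_mod _ (pow_permOrder σ), ← pow_add, Nat.sub_add_cancel a.2.le, pow_permOrder]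
  refine ⟨(permOrder σ - a) % permOrder σ, Finset.mem_filter.2
    ⟨Finset.mem_range.2 (Nat.mod_lt _ (permOrder_pos σ)), s, ?_⟩⟩
  rwa [hlag]

lemma logRatio_eq_zero (hF : ∀ s x, 0 < F s x)
    {n : ℕ} (hn : n ∈ Finset.range (permOrder σ)) (hn' : n ∉ lagSet σ F x' x)
    (s : Fin S) : logRatio σ F x' x n s = 0 := by
  simp only [lagSet, Finset.mem_filter, hn, true_and, not_exists, not_not] at hn'
  rw [logRatio, hn' s, div_self (hF _ _).ne', Real.log_one]

lemma klDiv_eq_zero (hF : ∀ s x, 0 < F s x)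
    {n : ℕ} (hn : n ∈ Finset.range (permOrder σ)) (hn' : n ∉ lagSet σ F x' x) :
    klDiv σ F x' x n = 0 :=
  Finset.sum_eq_zero fun s _ => by rw [logRatio_eq_zero hF hn hn', mul_zero]

lemma logMGF_eq_zero (hF : ∀ s x, 0 < F s x) (hF1 : ∀ x, ∑ s, F s x = 1)
    {n : ℕ} (hn : n ∈ Finset.range (permOrder σ)) (hn' : n ∉ lagSet σ F x' x)
    (t : ℝ) : logMGF σ F x' x n t = 0 := by
  simp [logMGF, logRatio_eq_zero hF hn hn', hF1]

lemma column_mem_stdSimplex (hF : ∀ s x, 0 < F s x) (hF1 : ∀ x, ∑ s, F s x = 1)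
    (z : Fin m) : (fun s => F s z) ∈ stdSimplex ℝ (Fin S) :=
  ⟨fun s => (hF s z).le, hF1 z⟩

lemma exp_logMGF (hF : ∀ s x, 0 < F s x) (hF1 : ∀ x, ∑ s, F s x = 1) (n : ℕ) (t : ℝ) :
    Real.exp (logMGF σ F x' x n t)
      = ∑ s, F s ((σ ^ (-(n : ℤ))) x') * Real.exp (t * logRatio σ F x' x n s) :=
  exp_cgf (column_mem_stdSimplex hF hF1 _) t

lemma logMGF_nonpos (hF : ∀ s x, 0 < F s x) (hF1 : ∀ x, ∑ s, F s x = 1)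
    (n : ℕ) {t : ℝ} (ht : -1 ≤ t) (ht0 : t ≤ 0) : logMGF σ F x' x n t ≤ 0 :=
  cgf_log_div_nonpos (column_mem_stdSimplex hF hF1 _) (column_mem_stdSimplex hF hF1 _)
    (fun s => hF s _) (fun s => hF s _) ht ht0

lemma logMGF_neg (hF : ∀ s x, 0 < F s x) (hF1 : ∀ x, ∑ s, F s x = 1)
    {n : ℕ} (hn : n ∈ lagSet σ F x' x) {t : ℝ} (ht : -1 < t) (ht0 : t < 0) :
    logMGF σ F x' x n t < 0 := by
  obtain ⟨s, hs⟩ := (Finset.mem_filter.1 hn).2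
  exact cgf_log_div_neg (column_mem_stdSimplex hF hF1 _) (column_mem_stdSimplex hF hF1 _)
    (fun s => hF s _) (fun s => hF s _) (fun h => hs (congrFun h s).symm) ht ht0

lemma mul_klDiv_le_logMGF (hF : ∀ s x, 0 < F s x) (hF1 : ∀ x, ∑ s, F s x = 1)
    (n : ℕ) (t : ℝ) : t * klDiv σ F x' x n ≤ logMGF σ F x' x n t :=
  mul_mean_le_cgf (column_mem_stdSimplex hF hF1 _) t

lemma klDiv_nonneg (hF : ∀ s x, 0 < F s x) (hF1 : ∀ x, ∑ s, F s x = 1)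
    (n : ℕ) : 0 ≤ klDiv σ F x' x n := by
  linarith [mul_klDiv_le_logMGF hF hF1 (σ := σ) (x' := x') (x := x) n (-1),
    logMGF_nonpos hF hF1 (σ := σ) (x' := x') (x := x) n le_rfl (by norm_num)]

lemma monotoneOn_logMGF_div (hF : ∀ s x, 0 < F s x) (hF1 : ∀ x, ∑ s, F s x = 1) (n : ℕ) :
    MonotoneOn (fun τ => logMGF σ F x' x n τ / τ) (Set.Iio 0) :=
  monotoneOn_cgf_div (column_mem_stdSimplex hF hF1 _)

lemma logMGF_div_le_klDiv (hF : ∀ s x, 0 < F s x) (hF1 : ∀ x, ∑ s, F s x = 1)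
    (n : ℕ) {τ : ℝ} (hτ : τ < 0) : logMGF σ F x' x n τ / τ ≤ klDiv σ F x' x n := by
  rw [div_le_iff_of_neg hτ, mul_comm]
  exact mul_klDiv_le_logMGF hF hF1 n τ

lemma logMGF_div_nonneg (hF : ∀ s x, 0 < F s x) (hF1 : ∀ x, ∑ s, F s x = 1)
    (n : ℕ) {τ : ℝ} (hτ : -1 ≤ τ) (hτ0 : τ ≤ 0) : 0 ≤ logMGF σ F x' x n τ / τ :=
  div_nonneg_of_nonpos (logMGF_nonpos hF hF1 n hτ hτ0) hτ0

lemma intervalIntegrable_logMGF_div (hF : ∀ s x, 0 < F s x) (hF1 : ∀ x, ∑ s, F s x = 1)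
    (n : ℕ) {a b : ℝ} (ha : a ∈ Set.Icc (-1 : ℝ) 0) (hb : b ∈ Set.Icc (-1 : ℝ) 0) :
    IntervalIntegrable (fun τ => logMGF σ F x' x n τ / τ) volume a b := by
  rw [intervalIntegrable_iff]
  refine Measure.integrableOn_of_bounded (M := klDiv σ F x' x n) (by simp [Set.uIoc]) ?_ ?_
  · exact ((continuous_cgf (column_mem_stdSimplex hF hF1 _)).measurable.div
      measurable_id).aestronglyMeasurable
  · refine (ae_restrict_iff' measurableSet_uIoc).2 (Eventually.of_forall fun τ hτ => ?_)
    obtain ⟨hτ1, hτ0⟩ := (Set.uIcc_subset_Icc ha hb) (Set.uIoc_subset_uIcc hτ)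
    rw [Real.norm_of_nonneg (logMGF_div_nonneg hF hF1 n hτ1 hτ0)]
    rcases hτ0.lt_or_eq with hneg | rfl
    · exact logMGF_div_le_klDiv hF hF1 n hneg
    · simpa using klDiv_nonneg hF hF1 n

lemma rateIntegral_neg (hF : ∀ s x, 0 < F s x) (hF1 : ∀ x, ∑ s, F s x = 1)
    (h : ∃ a, stacked σ F a x ≠ stacked σ F a x') : rateIntegral σ F x' x < 0 := by
  refine Finset.sum_neg (fun n hn => ?_) (lagSet_nonempty h)
  obtain ⟨hc1, hc0⟩ := neg_inv_permOrder_mem_Ico (σ := σ)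
  rw [intervalIntegral.integral_symm, neg_lt_zero]
  refine intervalIntegral.intervalIntegral_pos_of_pos_on
    (intervalIntegrable_logMGF_div hF hF1 n ⟨hc1, hc0.le⟩ (by simp)) (fun τ hτ => ?_) hc0
  exact div_pos_of_neg_of_neg (logMGF_neg hF hF1 hn (hc1.trans_lt hτ.1) hτ.2) hτ.2

lemma integral_logMGF_div_le (hF : ∀ s x, 0 < F s x) (hF1 : ∀ x, ∑ s, F s x = 1)
    (n : ℕ) {c v b : ℝ} (hc : c ∈ Set.Icc (-1 : ℝ) 0) (hv : v ∈ Set.Ico (-1 : ℝ) 0) (hb : -v ≤ b) :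
    ∫ τ in v..c, logMGF σ F x' x n τ / τ
      ≤ (∫ τ in (0 : ℝ)..c, logMGF σ F x' x n τ / τ) + b * klDiv σ F x' x n := by
  have hint {i j : ℝ} (hi : i ∈ Set.Icc (-1 : ℝ) 0) (hj : j ∈ Set.Icc (-1 : ℝ) 0) :=
    intervalIntegrable_logMGF_div hF hF1 (σ := σ) (x' := x') (x := x) n hi hj
  have h0 : (0 : ℝ) ∈ Set.Icc (-1 : ℝ) 0 := by simp
  have htail : ∫ τ in v..0, logMGF σ F x' x n τ / τ ≤ -v * klDiv σ F x' x n := by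
    have hmono := intervalIntegral.integral_mono_on_of_le_Ioo hv.2.le
      (hint ⟨hv.1, hv.2.le⟩ h0) intervalIntegrable_const
      fun τ hτ => logMGF_div_le_klDiv hF hF1 (σ := σ) (x' := x') (x := x) n hτ.2
    simpa using hmono
  rw [← intervalIntegral.integral_add_adjacent_intervals (hint ⟨hv.1, hv.2.le⟩ h0) (hint h0 hc),
    add_comm]
  exact add_le_add_right
    (htail.trans (mul_le_mul_of_nonneg_right hb (klDiv_nonneg hF hF1 n))) _

lemma sum_integral_logMGF_div_le (hF : ∀ s x, 0 < F s x) (hF1 : ∀ x, ∑ s, F s x = 1)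
    (K : ℕ) {v : ℕ → ℝ} {b : ℝ} (hv : ∀ n, v n ∈ Set.Ico (-1 : ℝ) 0) (hb : ∀ n, -v n ≤ b) :
    ∑ n ∈ Finset.range (permOrder σ),
        ∫ τ in v n..-(1 / (permOrder σ : ℝ)), logMGF σ F x' x (K + n) τ / τ
      ≤ rateIntegral σ F x' x + b * ∑ n ∈ lagSet σ F x' x, klDiv σ F x' x n := by
  have hper : Function.Periodic (fun n =>
      (∫ τ in (0 : ℝ)..-(1 / (permOrder σ : ℝ)), logMGF σ F x' x n τ / τ)
        + b * klDiv σ F x' x n) (permOrder σ) := fun n => by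
    simp only [periodic_logMGF n, periodic_klDiv n]
  calc _ ≤ _ := Finset.sum_le_sum fun n _ => integral_logMGF_div_le hF hF1 (K + n)
        (Set.Ico_subset_Icc_self neg_inv_permOrder_mem_Ico) (hv n) (hb n)
    _ = _ := sum_range_add_of_periodic hper K
    _ = _ := by
      rw [rateIntegral, Finset.mul_sum, ← Finset.sum_add_distrib]
      refine (Finset.sum_subset lagSet_subset_range fun n hn hn' => ?_).symm
      simp [logMGF_eq_zero hF hF1 hn hn', klDiv_eq_zero hF hn hn']

lemma sum_logMGF_grid_le (hF : ∀ s x, 0 < F s x) (hF1 : ∀ x, ∑ s, F s x = 1)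
    {v : ℕ → ℝ} (hv : ∀ n, v n ∈ Set.Ico (-1 : ℝ) 0) (hmono : ∀ n, v n ≤ v (n + permOrder σ))
    (hinit : ∀ n < permOrder σ, v n = -(1 / (permOrder σ : ℝ))) {θ b : ℝ} (hθ : 0 ≤ θ)
    (hstep : ∀ n, θ * (v (n + permOrder σ) - v n) ≤ (1 - θ) * -v (n + permOrder σ)) {K : ℕ}
    (hb : ∀ n, -v (K + n) ≤ b) :
    (1 - θ) * ∑ n ∈ Finset.range K, logMGF σ F x' x n (v (n + permOrder σ))
      ≤ θ * (rateIntegral σ F x' x + b * ∑ n ∈ lagSet σ F x' x, klDiv σ F x' x n) := by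
  set M := permOrder σ
  have hcell (n : ℕ) :
      θ * ((v (n + M) - v n) * (logMGF σ F x' x n (v (n + M)) / v (n + M)))
        ≤ (1 - θ) * -logMGF σ F x' x n (v (n + M)) :=
    calc θ * ((v (n + M) - v n) * (logMGF σ F x' x n (v (n + M)) / v (n + M)))
        = θ * (v (n + M) - v n) * (logMGF σ F x' x n (v (n + M)) / v (n + M)) := by ring
      _ ≤ (1 - θ) * -v (n + M) * (logMGF σ F x' x n (v (n + M)) / v (n + M)) :=
        mul_le_mul_of_nonneg_right (hstep n)
          (logMGF_div_nonneg hF hF1 n (hv _).1 (hv _).2.le)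
      _ = (1 - θ) * -logMGF σ F x' x n (v (n + M)) := by
        have hne := (hv (n + M)).2.ne
        field_simp
  have hriemann := sum_integral_le_sum_of_monotoneOn_of_periodic (K := K)
    (h := fun n τ => logMGF σ F x' x n τ / τ) (fun n => by simp only [periodic_logMGF n, M])
    Set.ordConnected_Ico
    (fun n => (monotoneOn_logMGF_div hF hF1 n).mono fun τ hτ => hτ.2) hv hmono
    fun n hn => by rw [hinit n hn, hinit 0 (permOrder_pos σ)]
  have hupper := Finset.sum_le_sum fun n (_ : n ∈ Finset.range K) => hcell n
  have hlower := sum_integral_logMGF_div_le hF hF1 (σ := σ) (x' := x') (x := x) K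
    (fun n => hv (K + n)) hb
  rw [← Finset.mul_sum, ← Finset.mul_sum, Finset.sum_neg_distrib] at hupper
  simp only [hinit 0 (permOrder_pos σ), intervalIntegral.integral_symm (v _),
    Finset.sum_neg_distrib] at hriemann
  have := mul_le_mul_of_nonneg_left hriemann hθ
  have := mul_le_mul_of_nonneg_left hlower hθ
  linarith

lemma sum_logMGF_geometric_le (hF : ∀ s x, 0 < F s x) (hF1 : ∀ x, ∑ s, F s x = 1)
    {q : ℝ} (hq0 : 0 < q) (hq1 : q < 1) (K : ℕ) :
    (1 - q ^ permOrder σ)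
        * ∑ n ∈ Finset.range K, logMGF σ F x' x n (-(1 / (permOrder σ : ℝ)) * q ^ n)
      ≤ q ^ permOrder σ * rateIntegral σ F x' x
        + q ^ K * ∑ n ∈ lagSet σ F x' x, 1 / (permOrder σ : ℝ) * klDiv σ F x' x n := by
  obtain ⟨hc1, hc0⟩ := neg_inv_permOrder_mem_Ico (σ := σ)
  set M := permOrder σ with hM
  set c : ℝ := 1 / (M : ℝ)
  have hqM : 0 < q ^ M := pow_pos hq0 M
  have hanti {i j : ℕ} (hij : i ≤ j) : q ^ j ≤ q ^ i := pow_le_pow_of_le_one hq0.le hq1.le hij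
  have hpow {i j : ℕ} (hij : i ≤ j) : q ^ M * q ^ (j - M) ≤ q ^ i := by
    rw [← pow_add]
    exact hanti (hij.trans le_add_tsub)
  -- The truncated exponent `n - M` makes the first `M` grid points equal to `-c`.
  have hgrid := sum_logMGF_grid_le hF hF1 (x' := x') (x := x) (σ := σ) (K := K)
    (v := fun n => -c * q ^ (n - M)) (θ := q ^ M) (b := c * q ^ K / q ^ M)
    (fun n => ⟨by nlinarith [pow_le_one₀ hq0.le hq1.le (n := n - M)],
      mul_neg_of_neg_of_pos hc0 (pow_pos hq0 _)⟩)
    (fun n => mul_le_mul_of_nonpos_left (hanti (by omega)) hc0.le)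
    (fun n hn => by rw [Nat.sub_eq_zero_of_le (hM ▸ hn.le), pow_zero, mul_one]) hqM.le
    (fun n => by
      rw [← hM, Nat.add_sub_cancel]
      nlinarith [hpow (le_refl n)])
    (fun n => by
      rw [le_div_iff₀ hqM]
      nlinarith [hpow (Nat.le_add_right K n)])
  simp only [← hM, Nat.add_sub_cancel] at hgrid
  refine hgrid.trans_eq ?_
  rw [← Finset.mul_sum]
  field_simp

lemma xi_pos (hF : ∀ s x, 0 < F s x) (hF1 : ∀ x, ∑ s, F s x = 1)
    (h : ∀ x x' : Fin m, x ≠ x' → ∃ a, stacked σ F a x ≠ stacked σ F a x') : 0 < xi σ F := by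
  refine lt_iInf_of_finite EReal.zero_lt_top fun x' => lt_iInf_of_finite EReal.zero_lt_top fun x =>
    lt_iInf_of_finite EReal.zero_lt_top fun hx => EReal.coe_pos.2 ?_
  exact mul_pos_of_neg_of_neg neg_inv_permOrder_mem_Ico.2 (rateIntegral_neg hF hF1 (h x x' hx))

lemma rateIntegral_add_neg_of_lt_xi {lam : ℝ} (hlam : (lam : EReal) < xi σ F) (hx : x ≠ x') :
    rateIntegral σ F x' x + lam * permOrder σ < 0 := by
  have h : (lam : EReal) < ((-(1 / (permOrder σ : ℝ)) * rateIntegral σ F x' x : ℝ) : EReal) :=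
    hlam.trans_le (iInf_le_of_le x' (iInf_le_of_le x (iInf_le _ hx)))
  have hM : (0 : ℝ) < permOrder σ := by exact_mod_cast permOrder_pos σ
  rw [EReal.coe_lt_coe_iff, neg_mul, one_div_mul_eq_div, ← neg_div, lt_div_iff₀ hM] at h
  linarith

lemma exists_isLargeWindow (w0 : Fin m → ℝ) {lam : ℝ} (hlam : (lam : EReal) < xi σ F) :
    ∃ α, IsLargeWindow σ F w0 lam α := by
  have hlarge : ∀ᶠ α : ℝ in atTop, IsLargeWindow σ F w0 lam α := by
    refine (eventually_gt_atTop 0).and ?_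
    simp only [eventually_all]
    intro x' x hx
    refine Tendsto.eventually_lt_const ?_ (((Real.tendsto_exp_neg_atTop_nhds_zero).mul_const
      _).const_add _)
    simpa using rateIntegral_add_neg_of_lt_xi hlam hx
  exact hlarge.exists

lemma one_sub_pow_le_exp_neg {δ α : ℝ} {K : ℕ} (hδ0 : 0 < δ) (hδ1 : δ < 1) (hK : α / δ ≤ K) :
    (1 - δ) ^ K ≤ Real.exp (-α) :=
  calc (1 - δ) ^ K ≤ Real.exp (-δ) ^ K :=
        pow_le_pow_left₀ (by linarith) (Real.one_sub_le_exp_neg δ) K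
    _ = Real.exp (K * -δ) := (Real.exp_nat_mul _ _).symm
    _ ≤ Real.exp (-α) := Real.exp_le_exp.2 (by linarith [(div_le_iff₀ hδ0).1 hK])

lemma one_sub_one_sub_pow_le_mul {δ : ℝ} (hδ : δ ≤ 1) (n : ℕ) : 1 - (1 - δ) ^ n ≤ n * δ := by
  have bernoulli := one_add_mul_le_pow (by linarith : (-2 : ℝ) ≤ -δ) n
  rw [← sub_eq_add_neg] at bernoulli
  linarith

lemma sum_klDiv_nonneg (hF : ∀ s x, 0 < F s x) (hF1 : ∀ x, ∑ s, F s x = 1) :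
    0 ≤ ∑ n ∈ lagSet σ F x' x, 1 / (permOrder σ : ℝ) * klDiv σ F x' x n :=
  Finset.sum_nonneg fun n _ => mul_nonneg (by positivity) (klDiv_nonneg hF hF1 n)

lemma sum_logMGF_le_div_sub (hF : ∀ s x, 0 < F s x) (hF1 : ∀ x, ∑ s, F s x = 1) {δ a : ℝ}
    {K : ℕ} (hδ0 : 0 < δ) (hδ1 : δ < 1) (hK : (1 - δ) ^ K ≤ a)
    (ha : rateIntegral σ F x' x
      + a * ∑ n ∈ lagSet σ F x' x, 1 / (permOrder σ : ℝ) * klDiv σ F x' x n ≤ 0) :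
    ∑ n ∈ Finset.range K, logMGF σ F x' x n (-(1 / (permOrder σ : ℝ)) * (1 - δ) ^ n)
      ≤ (rateIntegral σ F x' x
          + a * ∑ n ∈ lagSet σ F x' x, 1 / (permOrder σ : ℝ) * klDiv σ F x' x n)
        / (permOrder σ * δ) - rateIntegral σ F x' x := by
  have hgeom := sum_logMGF_geometric_le hF hF1 (σ := σ) (x' := x') (x := x)
    (sub_pos.2 hδ1) (sub_lt_self 1 hδ0) K
  have htail := mul_le_mul_of_nonneg_right hK
    (sum_klDiv_nonneg hF hF1 (σ := σ) (x' := x') (x := x))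
  have hpos : 0 < 1 - (1 - δ) ^ permOrder σ := sub_pos.2
    (pow_lt_one₀ (by linarith) (by linarith) (permOrder_pos σ).ne')
  have hinv := mul_le_mul_of_nonpos_left
    (inv_anti₀ hpos (one_sub_one_sub_pow_le_mul hδ1.le (permOrder σ))) ha
  rw [← div_eq_mul_inv, ← div_eq_mul_inv] at hinv
  rw [le_sub_iff_add_le]
  refine le_trans ((le_div_iff₀ hpos).2 ?_) hinv
  linarith

lemma IsLargeWindow.sum_logMGF_add_le (hF : ∀ s x, 0 < F s x) (hF1 : ∀ x, ∑ s, F s x = 1)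
    {w0 : Fin m → ℝ} {lam α δ : ℝ} (h : IsLargeWindow σ F w0 lam α) (hlam : 0 ≤ lam)
    (hx : x ≠ x') (hδ0 : 0 < δ) (hδ1 : δ < 1) {K : ℕ} (hK : α / δ ≤ K) :
    ∑ n ∈ Finset.range K, logMGF σ F x' x n (-(1 / (permOrder σ : ℝ)) * (1 - δ) ^ n)
        + 1 / (permOrder σ : ℝ) * ((1 - δ) ^ K * (2 * logitBound F w0 / δ))
      ≤ -lam / δ - rateIntegral σ F x' x := by
  have hM : (0 : ℝ) < permOrder σ := by exact_mod_cast permOrder_pos σ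
  have hrate := h.2 x' x hx
  have hW := logitBound_nonneg (F := F) w0
  have hqK := one_sub_pow_le_exp_neg hδ0 hδ1 hK
  have hinit : 1 / (permOrder σ : ℝ) * ((1 - δ) ^ K * (2 * logitBound F w0 / δ))
      ≤ Real.exp (-α) * (2 * logitBound F w0) / (permOrder σ * δ) :=
    calc 1 / (permOrder σ : ℝ) * ((1 - δ) ^ K * (2 * logitBound F w0 / δ))
        = (1 - δ) ^ K * (2 * logitBound F w0) / (permOrder σ * δ) := by field_simp
      _ ≤ Real.exp (-α) * (2 * logitBound F w0) / (permOrder σ * δ) := by gcongr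
  have hsum := sum_logMGF_le_div_sub hF hF1 hδ0 hδ1 hqK (σ := σ) (x' := x') (x := x) (by
    nlinarith [mul_nonneg hlam hM.le, mul_nonneg (Real.exp_pos (-α)).le hW])
  have hlam' : -lam / δ = -(lam * permOrder σ) / (permOrder σ * δ) := by field_simp
  refine (add_le_add hsum hinit).trans ?_
  rw [sub_add_eq_add_sub, ← add_div, hlam']
  exact sub_le_sub_right (div_le_div_of_nonneg_right (by linarith) (by positivity)) _

end Rate

section Filter

variable {m r S : ℕ}

/-- The filter on the recurrent states, where it is finite. -/
noncomputable def recLogit (σ : Equiv.Perm (Fin m)) (F : Matrix (Fin S) (Fin m) ℝ) (δ : ℝ)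
    (w0 : Fin m → ℝ) (y : ℕ → Fin S) : ℕ → Fin m → ℝ
  | 0 => w0
  | k + 1 => fun x =>
      (1 - δ) * recLogit σ F δ w0 y k (σ⁻¹ x) + δ * Real.log (F (y (k + 1)) x)

lemma alf_inl (σ : Equiv.Perm (Fin m)) {E : Matrix (Fin S) (State m r) ℝ}
    (hE : ∀ s x, 0 < recEmission E s x) (δ : ℝ) (w0 : Fin m → ℝ) (y : ℕ → Fin S) (k : ℕ)
    (x : Fin m) :
    alf σ E δ w0 y k (Sum.inl x) = (recLogit σ (recEmission E) δ w0 y k x : ℝ) := by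
  induction k generalizing x with
  | zero => rfl
  | succ k ih =>
    have hpos : 0 < E (y (k + 1)) (Sum.inl x) := hE (y (k + 1)) x
    have hσ : σ (σ⁻¹ x) = x := σ.apply_symm_apply x
    simp only [alf, alfStep, recLogit, Fintype.sum_sum_type, fromBlocks_apply₁₁,
      fromBlocks_apply₁₂, Matrix.zero_apply, EReal.coe_zero, zero_mul, Finset.sum_const_zero,
      add_zero, ih]
    rw [Finset.sum_eq_single (σ⁻¹ x), mulVec_single_one]
    · simp only [permMat, of_apply, col_apply, transpose_apply, recEmission,
        hσ, if_true, EReal.coe_one, one_mul]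
      rw [ENNReal.log_ofReal_of_pos hpos]
      push_cast
      rfl
    · intro j _ hj
      have hx : x ≠ σ j := fun h => hj (h ▸ (σ.symm_apply_apply j).symm)
      simp [permMat, hx]
    · simp

lemma alf_inr (σ : Equiv.Perm (Fin m)) (E : Matrix (Fin S) (State m r) ℝ) {δ : ℝ} (hδ : δ < 1)
    (w0 : Fin m → ℝ) (y : ℕ → Fin S) (k : ℕ) (z : Fin r) :
    alf σ E δ w0 y k (Sum.inr z) = ⊥ := by
  induction k generalizing z with
  | zero => rfl
  | succ k ih =>
    have hbot : ((1 - δ : ℝ) : EReal) * ⊥ = ⊥ := EReal.coe_mul_bot_of_pos (sub_pos.2 hδ)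
    simp only [alf, alfStep, Fintype.sum_sum_type, fromBlocks_apply₂₁,
      fromBlocks_apply₂₂, Matrix.zero_apply, EReal.coe_zero, zero_mul, Finset.sum_const_zero,
      zero_add, ih, hbot]
    rw [Finset.sum_eq_single z]
    · simp
    · intro j _ hj
      simp [Matrix.one_apply_ne hj.symm]
    · simp

lemma exists_recLogit_le (σ : Equiv.Perm (Fin m)) {E : Matrix (Fin S) (State m r) ℝ}
    (hE : ∀ s x, 0 < recEmission E s x) {δ : ℝ} (hδ : δ < 1) {w0 : Fin m → ℝ} {y : ℕ → Fin S}
    {k : ℕ} {x' : Fin m} (h : argmax (alf σ E δ w0 y k) ≠ {Sum.inl x'}) :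
    ∃ x, x ≠ x' ∧ recLogit σ (recEmission E) δ w0 y k x'
      ≤ recLogit σ (recEmission E) δ w0 y k x := by
  by_contra! hc
  refine h (Set.eq_singleton_iff_unique_mem.2 ⟨?_, ?_⟩)
  · rintro (x | z)
    · rw [alf_inl σ hE, alf_inl σ hE, EReal.coe_le_coe_iff]
      rcases eq_or_ne x x' with rfl | hx
      exacts [le_rfl, (hc x hx).le]
    · rw [alf_inr σ E hδ]
      exact bot_le
  · rintro (x | z) hx <;> specialize hx (Sum.inl x')
    · rw [alf_inl σ hE, alf_inl σ hE, EReal.coe_le_coe_iff] at hx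
      by_contra hne
      exact absurd hx (hc x fun h => hne (by rw [h])).not_ge
    · rw [alf_inl σ hE, alf_inr σ E hδ] at hx
      exact absurd hx (by simp)

lemma abs_recLogit_le (σ : Equiv.Perm (Fin m)) (F : Matrix (Fin S) (Fin m) ℝ) {δ : ℝ}
    (hδ : 0 ≤ δ) (hδ1 : δ ≤ 1) (w0 : Fin m → ℝ) (y : ℕ → Fin S) (k : ℕ) (x : Fin m) :
    |recLogit σ F δ w0 y k x| ≤ logitBound F w0 := by
  induction k generalizing x with
  | zero => exact abs_init_le_logitBound w0 x
  | succ k ih =>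
    calc |recLogit σ F δ w0 y (k + 1) x|
        ≤ |(1 - δ) * recLogit σ F δ w0 y k (σ⁻¹ x)| + |δ * Real.log (F (y (k + 1)) x)| :=
          abs_add_le _ _
      _ = (1 - δ) * |recLogit σ F δ w0 y k (σ⁻¹ x)| + δ * |Real.log (F (y (k + 1)) x)| := by
          rw [abs_mul, abs_mul, abs_of_nonneg hδ, abs_of_nonneg (sub_nonneg.2 hδ1)]
      _ ≤ (1 - δ) * logitBound F w0 + δ * logitBound F w0 :=
          add_le_add (mul_le_mul_of_nonneg_left (ih _) (sub_nonneg.2 hδ1))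
            (mul_le_mul_of_nonneg_left (abs_log_le_logitBound w0 _ _) hδ)
      _ = logitBound F w0 := by ring

lemma recLogit_eq_window_sum (σ : Equiv.Perm (Fin m)) (F : Matrix (Fin S) (Fin m) ℝ) (δ : ℝ)
    (w0 : Fin m → ℝ) (y : ℕ → Fin S) {K k : ℕ} (hK : K ≤ k) (x : Fin m) :
    recLogit σ F δ w0 y k x
      = δ * ∑ n ∈ Finset.range K, (1 - δ) ^ n * Real.log (F (y (k - n)) ((σ ^ (-(n : ℤ))) x))
        + (1 - δ) ^ K * recLogit σ F δ w0 y (k - K) ((σ ^ (-(K : ℤ))) x) := by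
  induction K with
  | zero => simp
  | succ K ih =>
    obtain ⟨l, hl⟩ : ∃ l, k - K = l + 1 := ⟨k - K - 1, by omega⟩
    have hl' : k - (K + 1) = l := by omega
    have hpow : σ⁻¹ ((σ ^ (-(K : ℤ))) x) = (σ ^ (-((K + 1 : ℕ) : ℤ))) x := by
      rw [← Equiv.Perm.mul_apply, ← _root_.zpow_neg_one, ← _root_.zpow_add, Nat.cast_succ,
        neg_add_rev]
    rw [ih (by omega), Finset.sum_range_succ, hl, hl', ← hpow]
    simp only [recLogit]
    ring

lemma sum_logRatio_le_of_recLogit_le {σ : Equiv.Perm (Fin m)} {F : Matrix (Fin S) (Fin m) ℝ}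
    (hF : ∀ s x, 0 < F s x) {δ : ℝ} (hδ : 0 < δ) (hδ1 : δ ≤ 1) {w0 : Fin m → ℝ} {y : ℕ → Fin S}
    {K k : ℕ} (hK : K ≤ k) {x' x : Fin m}
    (h : recLogit σ F δ w0 y k x' ≤ recLogit σ F δ w0 y k x) :
    ∑ n ∈ Finset.range K, (1 - δ) ^ n * logRatio σ F x' x n (y (k - n))
      ≤ (1 - δ) ^ K * (2 * logitBound F w0 / δ) := by
  have hsplit : ∑ n ∈ Finset.range K, (1 - δ) ^ n * logRatio σ F x' x n (y (k - n))
      = ∑ n ∈ Finset.range K, (1 - δ) ^ n * Real.log (F (y (k - n)) ((σ ^ (-(n : ℤ))) x'))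
        - ∑ n ∈ Finset.range K, (1 - δ) ^ n * Real.log (F (y (k - n)) ((σ ^ (-(n : ℤ))) x)) := by
    rw [← Finset.sum_sub_distrib]
    refine Finset.sum_congr rfl fun n _ => ?_
    rw [logRatio, Real.log_div (hF _ _).ne' (hF _ _).ne', mul_sub]
  have hx' := (abs_le.1 (abs_recLogit_le σ F hδ.le hδ1 w0 y (k - K) ((σ ^ (-(K : ℤ))) x'))).1
  have hx := (abs_le.1 (abs_recLogit_le σ F hδ.le hδ1 w0 y (k - K) ((σ ^ (-(K : ℤ))) x))).2
  have hpow : 0 ≤ (1 - δ) ^ K := pow_nonneg (sub_nonneg.2 hδ1) K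
  rw [recLogit_eq_window_sum σ F δ w0 y hK x', recLogit_eq_window_sum σ F δ w0 y hK x] at h
  rw [hsplit, ← mul_div_assoc, le_div_iff₀ hδ]
  linarith [mul_le_mul_of_nonneg_left hx hpow, mul_le_mul_of_nonneg_left hx' hpow]

end Filter

section FiniteValued

variable {Ω ι : Type*} [MeasurableSpace Ω] {μ : Measure Ω} [IsFiniteMeasure μ] [Finite ι]

lemma measureReal_inter_le_of_forall_fiber {Z : Ω → ι} (hZ : ∀ c, MeasurableSet (Z ⁻¹' {c}))
    {N : Set Ω} {b : ℝ} (hN : ∀ c, μ.real (Z ⁻¹' {c} ∩ N) ≤ b * μ.real (Z ⁻¹' {c}))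
    {A : Set Ω} (hA : ∀ ω ω', Z ω = Z ω' → ω ∈ A → ω' ∈ A) :
    μ.real (A ∩ N) ≤ b * μ.real A := by
  obtain ⟨s, hs⟩ := (Z '' A).toFinite.exists_finset_coe
  have hAs : A = ⋃ c ∈ s, Z ⁻¹' {c} := by
    ext ω
    simp only [← Finset.mem_coe, hs, Set.mem_iUnion, Set.mem_preimage, Set.mem_singleton_iff,
      exists_prop, exists_eq_right']
    exact ⟨Set.mem_image_of_mem Z, fun ⟨ω', hω', h⟩ => hA ω' ω h hω'⟩
  calc μ.real (A ∩ N) = μ.real (⋃ c ∈ s, Z ⁻¹' {c} ∩ N) := by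
        conv_lhs => rw [hAs, Set.iUnion₂_inter]
    _ ≤ ∑ c ∈ s, μ.real (Z ⁻¹' {c} ∩ N) := measureReal_biUnion_finset_le _ _
    _ ≤ ∑ c ∈ s, b * μ.real (Z ⁻¹' {c}) := Finset.sum_le_sum fun c _ => hN c
    _ = b * μ.real A := by
        conv_rhs => rw [hAs]
        rw [← Finset.mul_sum, measureReal_biUnion_finset
          (fun c _ d _ hcd => (Set.disjoint_singleton.2 hcd).preimage Z) fun c _ => hZ c]

end FiniteValued

section History

variable {Ω : Type*} {m r S : ℕ} {X : ℕ → Ω → State m r} {Y : ℕ → Ω → Fin S} {n : ℕ}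

/-- The states `X 0, …, X n` and the observations `Y 1, …, Y n`, on which the filter and the
hidden chain up to time `n` depend. -/
def history (X : ℕ → Ω → State m r) (Y : ℕ → Ω → Fin S) (n : ℕ) (ω : Ω) :
    (Fin (n + 1) → State m r) × (Fin n → Fin S) :=
  (fun i => X i ω, fun i => Y (i + 1) ω)

lemma history_preimage_singleton (x : ℕ → State m r) (y : ℕ → Fin S) :
    history X Y n ⁻¹' {(fun i : Fin (n + 1) => x i, fun i : Fin n => y (i + 1))}
      = {ω | (∀ k ≤ n, X k ω = x k) ∧ ∀ k, 1 ≤ k → k ≤ n → Y k ω = y k} := by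
  ext ω
  simp only [history, Set.mem_preimage, Set.mem_singleton_iff, Prod.mk.injEq, funext_iff,
    Fin.forall_iff, Nat.lt_succ_iff, Set.mem_ofPred_eq]
  refine and_congr_right fun _ => ⟨fun h k hk hkn => ?_, fun h k hk => h (k + 1) k.succ_pos hk⟩
  simpa only [Nat.sub_add_cancel hk] using h (k - 1) (by omega)

lemma history_eq_iff {ω ω' : Ω} : history X Y n ω = history X Y n ω' ↔
    (∀ k ≤ n, X k ω = X k ω') ∧ ∀ k, 1 ≤ k → k ≤ n → Y k ω = Y k ω' :=
  Set.ext_iff.1 (history_preimage_singleton (fun k => X k ω') fun k => Y k ω') ω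

lemma exists_seq_extending {α : Type*} (c : Fin n → α) (a : α) :
    ∃ x : ℕ → α, (fun i : Fin n => x i) = c ∧ x n = a :=
  ⟨fun k => if h : k < n then c ⟨k, h⟩ else a, by simp, by simp⟩

lemma window_subset_iUnion_inter_next (X : ℕ → Ω → State m r) (Y : ℕ → Ω → Fin S) (K l : ℕ)
    (x : ℕ → State m r) (g : ℕ → Fin S → ℝ) (b : ℝ) :
    {ω | (∀ n < K + 1, X (l + 1 - n) ω = x n) ∧
        ∑ n ∈ Finset.range (K + 1), g n (Y (l + 1 - n) ω) ≤ b}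
      ⊆ ⋃ s ∈ Finset.univ, {ω | (∀ n < K, X (l - n) ω = x (n + 1)) ∧
          ∑ n ∈ Finset.range K, g (n + 1) (Y (l - n) ω) ≤ b - g 0 s}
        ∩ {ω | X (l + 1) ω = x 0 ∧ Y (l + 1) ω = s} := by
  rintro ω ⟨hx, hsum⟩
  rw [Finset.sum_range_succ'] at hsum
  simp only [Nat.add_sub_add_right, Nat.sub_zero] at hsum
  simp only [Finset.mem_univ, Set.iUnion_true, Set.mem_iUnion]
  refine ⟨Y (l + 1) ω, ⟨fun n hn => ?_, le_sub_iff_add_le.2 hsum⟩, hx 0 K.succ_pos, rfl⟩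
  simpa only [Nat.add_sub_add_right] using hx (n + 1) (by omega)

end History

namespace IsHMM

variable {Ω : Type*} [MeasurableSpace Ω] {μ : Measure Ω} {m r S : ℕ}
  {X : ℕ → Ω → State m r} {Y : ℕ → Ω → Fin S} {π₀ : State m r → ℝ}
  {T : Matrix (State m r) (State m r) ℝ} {E : Matrix (Fin S) (State m r) ℝ}

lemma measurableSet_state (h : IsHMM μ X Y π₀ T E) (k : ℕ) (a : State m r) :
    MeasurableSet {ω | X k ω = a} := by
  have ha : MeasurableSet ({a} : Set (State m r)) := by
    rcases a with x | z
    · simpa using (measurableSet_singleton x).inl_image (β := Fin r)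
    · simpa using (measurableSet_singleton z).inr_image (α := Fin m)
  exact h.meas_state k ha

lemma measurableSet_obs (h : IsHMM μ X Y π₀ T E) (k : ℕ) (s : Fin S) :
    MeasurableSet {ω | Y k ω = s} :=
  h.meas_obs k (measurableSet_singleton s)

lemma measurableSet_history (h : IsHMM μ X Y π₀ T E) (n : ℕ)
    (c : (Fin (n + 1) → State m r) × (Fin n → Fin S)) :
    MeasurableSet (history X Y n ⁻¹' {c}) := by
  have hc : history X Y n ⁻¹' {c}
      = (⋂ i : Fin (n + 1), {ω | X i ω = c.1 i}) ∩ ⋂ i : Fin n, {ω | Y (i + 1) ω = c.2 i} := by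
    ext ω
    simp [history, Prod.ext_iff, funext_iff]
  rw [hc]
  exact (MeasurableSet.iInter fun i => h.measurableSet_state _ _).inter
    (MeasurableSet.iInter fun i => h.measurableSet_obs _ _)

lemma measureReal_history_inter_next (h : IsHMM μ X Y π₀ T E) {n : ℕ}
    (c : (Fin (n + 1) → State m r) × (Fin n → Fin S)) (a : State m r) (s : Fin S) :
    μ.real (history X Y n ⁻¹' {c} ∩ {ω | X (n + 1) ω = a ∧ Y (n + 1) ω = s})
      = T a (c.1 (Fin.last n)) * E s a * μ.real (history X Y n ⁻¹' {c}) := by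
  obtain ⟨c₁, c₂⟩ := c
  obtain ⟨x, rfl, rfl⟩ := exists_seq_extending c₁ a
  obtain ⟨y, rfl, rfl⟩ := exists_seq_extending c₂ s
  have hpast : history X Y n ⁻¹' {(fun i : Fin (n + 1) => x i, fun i : Fin n => y i)}
      = {ω | (∀ k ≤ n, X k ω = x k) ∧ ∀ k, 1 ≤ k → k ≤ n → Y k ω = y (k - 1)} :=
    history_preimage_singleton x fun k => y (k - 1)
  have hnext : {ω | (∀ k ≤ n, X k ω = x k) ∧ ∀ k, 1 ≤ k → k ≤ n → Y k ω = y (k - 1)}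
        ∩ {ω | X (n + 1) ω = x (n + 1) ∧ Y (n + 1) ω = y n}
      = {ω | (∀ k ≤ n + 1, X k ω = x k) ∧ ∀ k, 1 ≤ k → k ≤ n + 1 → Y k ω = y (k - 1)} := by
    ext ω
    simp only [Set.mem_inter_iff, Set.mem_ofPred_eq]
    grind
  rw [hpast, hnext, h.joint_law n x fun k => y (k - 1), h.joint_law (n + 1) x fun k => y (k - 1),
    Finset.prod_range_succ]
  simp only [Fin.val_last, Nat.add_sub_cancel]
  ring

lemma measureReal_inter_next_le (h : IsHMM μ X Y π₀ T E) (hE : ∀ s a, 0 ≤ E s a)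
    (hT : ∀ a b, T a b ≤ 1) {n : ℕ} {A : Set Ω}
    (hA : ∀ ω ω', history X Y n ω = history X Y n ω' → ω ∈ A → ω' ∈ A)
    (a : State m r) (s : Fin S) :
    μ.real (A ∩ {ω | X (n + 1) ω = a ∧ Y (n + 1) ω = s}) ≤ E s a * μ.real A := by
  have := h.prob
  refine measureReal_inter_le_of_forall_fiber (h.measurableSet_history n) (fun c => ?_) hA
  rw [h.measureReal_history_inter_next]
  exact mul_le_mul_of_nonneg_right (mul_le_of_le_one_left (hE s a) (hT _ _)) measureReal_nonneg

lemma measureReal_history_inter_next_state (h : IsHMM μ X Y π₀ T E) (hE : ∀ a, ∑ s, E s a = 1)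
    {n : ℕ} (c : (Fin (n + 1) → State m r) × (Fin n → Fin S)) (a : State m r) :
    μ.real (history X Y n ⁻¹' {c} ∩ {ω | X (n + 1) ω = a})
      = T a (c.1 (Fin.last n)) * μ.real (history X Y n ⁻¹' {c}) := by
  have := h.prob
  have hunion : history X Y n ⁻¹' {c} ∩ {ω | X (n + 1) ω = a}
      = ⋃ s ∈ Finset.univ,
          history X Y n ⁻¹' {c} ∩ {ω | X (n + 1) ω = a ∧ Y (n + 1) ω = s} := by
    ext ω
    simp
  rw [hunion, measureReal_biUnion_finset]
  · simp only [h.measureReal_history_inter_next]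
    rw [← Finset.sum_mul, ← Finset.mul_sum, hE, mul_one]
  · exact fun s _ s' _ hs => Set.disjoint_left.2 fun ω hω hω' => hs (hω.2.2.symm.trans hω'.2.2)
  · exact fun s _ => (h.measurableSet_history n c).inter
      ((h.measurableSet_state _ _).inter (h.measurableSet_obs _ _))

lemma measureReal_jump_le (h : IsHMM μ X Y π₀ T E) (hE : ∀ a, ∑ s, E s a = 1)
    {f : State m r → State m r} {b : ℝ} (hb : ∀ j, 1 - T (f j) j ≤ b) (n : ℕ) :
    μ.real {ω | X (n + 1) ω ≠ f (X n ω)} ≤ b := by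
  have := h.prob
  have hfiber (c) : μ.real (history X Y n ⁻¹' {c} ∩ {ω | X (n + 1) ω ≠ f (X n ω)})
      ≤ b * μ.real (history X Y n ⁻¹' {c}) := by
    set j := c.1 (Fin.last n)
    have hj : history X Y n ⁻¹' {c} ∩ {ω | X (n + 1) ω ≠ f (X n ω)}
        = history X Y n ⁻¹' {c} \ {ω | X (n + 1) ω = f j} := by
      ext ω
      refine and_congr_right fun hω => ?_
      have hX : X n ω = j := congr_fun (congr_arg Prod.fst hω) (Fin.last n)
      simp [hX]
    have hsplit := measureReal_inter_add_sdiff (μ := μ) (s := history X Y n ⁻¹' {c})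
      (h.measurableSet_state (n + 1) (f j))
    rw [h.measureReal_history_inter_next_state hE] at hsplit
    rw [hj, eq_sub_of_add_eq' hsplit, ← one_sub_mul]
    exact mul_le_mul_of_nonneg_right (hb j) measureReal_nonneg
  simpa using measureReal_inter_le_of_forall_fiber (h.measurableSet_history n) hfiber
    (A := Set.univ) fun _ _ _ _ => trivial

/-- Chernoff's bound, with the observations along the path integrated out one at a time, the latest
first. -/
lemma measureReal_window_le (h : IsHMM μ X Y π₀ T E) (hE : ∀ s a, 0 ≤ E s a)
    (hT : ∀ a b, T a b ≤ 1) {K k : ℕ} (hK : K ≤ k) (x : ℕ → State m r) (g : ℕ → Fin S → ℝ)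
    (b : ℝ) :
    μ.real {ω | (∀ n < K, X (k - n) ω = x n) ∧ ∑ n ∈ Finset.range K, g n (Y (k - n) ω) ≤ b}
      ≤ Real.exp b * ∏ n ∈ Finset.range K, ∑ s, E s (x n) * Real.exp (-g n s) := by
  have := h.prob
  induction K generalizing k x g b with
  | zero =>
    by_cases hb : 0 ≤ b
    · simpa using measureReal_le_one.trans (Real.one_le_exp hb)
    · simp [hb, Real.exp_nonneg]
  | succ K ih =>
    obtain ⟨l, rfl⟩ : ∃ l, k = l + 1 := ⟨k - 1, by omega⟩
    let A (s : Fin S) : Set Ω := {ω | (∀ n < K, X (l - n) ω = x (n + 1)) ∧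
      ∑ n ∈ Finset.range K, g (n + 1) (Y (l - n) ω) ≤ b - g 0 s}
    have hA (s) (ω ω' : Ω) (hω : history X Y l ω = history X Y l ω') : ω ∈ A s → ω' ∈ A s := by
      obtain ⟨hX, hY⟩ := history_eq_iff.1 hω
      rintro ⟨hx, hsum⟩
      refine ⟨fun n hn => (hX _ (Nat.sub_le _ _)).symm.trans (hx n hn),
        (Finset.sum_congr rfl fun n hn => ?_).trans_le hsum⟩
      rw [Finset.mem_range] at hn
      rw [hY (l - n) (by omega) (by omega)]
    calc _ ≤ ∑ s, μ.real (A s ∩ {ω | X (l + 1) ω = x 0 ∧ Y (l + 1) ω = s}) :=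
          (measureReal_mono (window_subset_iUnion_inter_next X Y K l x g b)
            (measure_ne_top _ _)).trans (measureReal_biUnion_finset_le _ _)
      _ ≤ ∑ s, E s (x 0) * (Real.exp (b - g 0 s)
            * ∏ n ∈ Finset.range K, ∑ s, E s (x (n + 1)) * Real.exp (-g (n + 1) s)) :=
          Finset.sum_le_sum fun s _ =>
            (h.measureReal_inter_next_le hE hT (hA s) (x 0) s).trans
              (mul_le_mul_of_nonneg_left (ih (by omega) _ _ _) (hE _ _))
      _ = _ := by
          rw [Finset.prod_range_succ', Finset.mul_sum, Finset.mul_sum]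
          refine Finset.sum_congr rfl fun s _ => ?_
          rw [sub_eq_add_neg, Real.exp_add]
          ring

end IsHMM

section Drift

variable {ι : Type*} [DecidableEq ι]

/-- The matrix of a self-map: its column `j` is the basis vector of `f j`. It provides the map
`j ↦ n_j` of a deterministic matrix. -/
def mapMatrix (f : ι → ι) : Matrix ι ι ℝ :=
  Matrix.of fun i j => if i = f j then 1 else 0

lemma IsDeterministic.exists_eq_mapMatrix {D : Matrix ι ι ℝ} (hD : IsDeterministic D) :
    ∃ f, D = mapMatrix f := by
  choose f hf using hD
  exact ⟨f, Matrix.ext fun i j => (congr_fun (hf j) i).trans (Pi.single_apply _ _ _)⟩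

lemma mapMatrix_self (f : ι → ι) (j : ι) : mapMatrix f (f j) j = 1 :=
  if_pos rfl

variable [Fintype ι]

lemma mapMatrix_pow (f : ι → ι) (n : ℕ) : mapMatrix f ^ n = mapMatrix f^[n] := by
  induction n with
  | zero => rfl
  | succ n ih =>
    rw [pow_succ', ih]
    ext i j
    simp [mapMatrix, Matrix.mul_apply, Function.iterate_succ_apply']

variable {f : ι → ι} {Q : Matrix ι ι ℝ}

namespace IsDrift

lemma nonneg_of_ne (hQ : IsDrift (mapMatrix f) Q) {i j : ι} (hij : i ≠ f j) : 0 ≤ Q i j :=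
  (hQ j (f j) (mapMatrix_self f j)).1 i hij

lemma apply_next_eq (hQ : IsDrift (mapMatrix f) Q) (j : ι) :
    Q (f j) j = -∑ i ∈ Finset.univ.erase (f j), Q i j :=
  (hQ j (f j) (mapMatrix_self f j)).2

lemma apply_next_nonpos (hQ : IsDrift (mapMatrix f) Q) (j : ι) : Q (f j) j ≤ 0 := by
  rw [hQ.apply_next_eq, neg_nonpos]
  exact Finset.sum_nonneg fun i hi => hQ.nonneg_of_ne (Finset.ne_of_mem_erase hi)

lemma le_neg_apply_next (hQ : IsDrift (mapMatrix f) Q) {i j : ι} (hij : i ≠ f j) :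
    Q i j ≤ -Q (f j) j := by
  rw [hQ.apply_next_eq, neg_neg]
  exact Finset.single_le_sum (f := fun i => Q i j)
    (fun i hi => hQ.nonneg_of_ne (Finset.ne_of_mem_erase hi)) (by simpa using hij)

end IsDrift

lemma qMin_mapMatrix_le (f : ι → ι) (Q : Matrix ι ι ℝ) (j : ι) :
    qMin (mapMatrix f) Q ≤ Q (f j) j := by
  have hj : ∑ i, mapMatrix f i j * Q i j = Q (f j) j := by simp [mapMatrix]
  exact hj ▸ ciInf_le (Set.finite_range fun j => ∑ i, mapMatrix f i j * Q i j).bddBelow j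

lemma one_sub_transition_le (f : ι → ι) (Q : Matrix ι ι ℝ) {ε : ℝ} (hε : 0 ≤ ε) (j : ι) :
    1 - (mapMatrix f + ε • Q) (f j) j ≤ -qMin (mapMatrix f) Q * ε := by
  simp only [Matrix.add_apply, Matrix.smul_apply, smul_eq_mul, mapMatrix_self]
  linarith [mul_le_mul_of_nonneg_left (qMin_mapMatrix_le f Q j) hε]

lemma IsDrift.qMin_neg (hQ : IsDrift (mapMatrix f) Q) (hne : Q ≠ 0) :
    qMin (mapMatrix f) Q < 0 := by
  contrapose! hne
  have hnext (j) : Q (f j) j = 0 :=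
    le_antisymm (hQ.apply_next_nonpos j) (hne.trans (qMin_mapMatrix_le f Q j))
  ext i j
  rcases eq_or_ne i (f j) with rfl | hij
  · exact hnext j
  · exact le_antisymm ((hQ.le_neg_apply_next hij).trans_eq (by simp [hnext]))
      (hQ.nonneg_of_ne hij)

lemma IsDrift.transition_le_one (hQ : IsDrift (mapMatrix f) Q) {ε : ℝ} (hε : 0 ≤ ε)
    (hε1 : -qMin (mapMatrix f) Q * ε ≤ 1) (i j : ι) : (mapMatrix f + ε • Q) i j ≤ 1 := by
  rcases eq_or_ne i (f j) with rfl | hij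
  · simpa [mapMatrix_self] using mul_nonpos_of_nonneg_of_nonpos hε (hQ.apply_next_nonpos j)
  · have hD : mapMatrix f i j = 0 := if_neg hij
    have hQij : Q i j ≤ -qMin (mapMatrix f) Q :=
      (hQ.le_neg_apply_next hij).trans (neg_le_neg (qMin_mapMatrix_le f Q j))
    calc (mapMatrix f + ε • Q) i j = Q i j * ε := by simp [hD, mul_comm]
      _ ≤ -qMin (mapMatrix f) Q * ε := mul_le_mul_of_nonneg_right hQij hε
      _ ≤ 1 := hε1

end Drift

section Backbone

lemma exists_fromBlocks_zero₂₁_pow {m n R : Type*} [Fintype m] [Fintype n] [DecidableEq m]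
    [DecidableEq n] [Semiring R] (A : Matrix m m R) (B : Matrix m n R) (C : Matrix n n R) (k : ℕ) :
    ∃ B' : Matrix m n R, fromBlocks A B 0 C ^ k = fromBlocks (A ^ k) B' 0 (C ^ k) := by
  induction k with
  | zero => exact ⟨0, by simp only [pow_zero, fromBlocks_one]⟩
  | succ k ih =>
    obtain ⟨B', hB'⟩ := ih
    exact ⟨A ^ k * B + B' * C, by simp [pow_succ, hB', fromBlocks_multiply]⟩

variable {m r : ℕ} {σ : Equiv.Perm (Fin m)} {D₁₂ : Matrix (Fin m) (Fin r) ℝ}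
  {D₂₂ : Matrix (Fin r) (Fin r) ℝ} {f : State m r → State m r}

lemma next_inl (hf : mapMatrix f = fromBlocks (permMat σ) D₁₂ 0 D₂₂) (x : Fin m) :
    f (Sum.inl x) = Sum.inl (σ x) := by
  have h : mapMatrix f (Sum.inl (σ x)) (Sum.inl x) = 1 := by simp [hf, permMat]
  by_contra hne
  exact zero_ne_one ((if_neg (Ne.symm hne)).symm.trans h)

lemma iterate_inl (hf : mapMatrix f = fromBlocks (permMat σ) D₁₂ 0 D₂₂) (n : ℕ) (x : Fin m) :
    f^[n] (Sum.inl x) = Sum.inl ((σ ^ n) x) := by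
  induction n with
  | zero => rfl
  | succ n ih => rw [Function.iterate_succ_apply', ih, next_inl hf, pow_succ', Equiv.Perm.mul_apply]

lemma exists_iterate_eq_inl (hf : mapMatrix f = fromBlocks (permMat σ) D₁₂ 0 D₂₂)
    (hnil : IsNilpotent D₂₂) : ∃ L : ℕ, ∀ j, ∃ x, f^[L] j = Sum.inl x := by
  obtain ⟨L, hL⟩ := hnil
  obtain ⟨B, hB⟩ := exists_fromBlocks_zero₂₁_pow (permMat σ) D₁₂ D₂₂ L
  rw [← hf, mapMatrix_pow, hL] at hB
  refine ⟨L, ?_⟩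
  rintro (x | b)
  · exact ⟨_, iterate_inl hf L x⟩
  · rcases hb : f^[L] (Sum.inr b) with x | c
    · exact ⟨x, rfl⟩
    · have hc := mapMatrix_self f^[L] (Sum.inr b)
      simp [hb, hB] at hc

lemma exists_recurrent_path (hf : mapMatrix f = fromBlocks (permMat σ) D₁₂ 0 D₂₂) {L : ℕ}
    (hL : ∀ j, ∃ x, f^[L] j = Sum.inl x) (u : ℕ → State m r) {K j : ℕ}
    (hu : ∀ i < K + L, u (j + i + 1) = f (u (j + i))) :
    ∃ x', ∀ n ≤ K, u (j + (K + L) - n) = Sum.inl ((σ ^ (-(n : ℤ))) x') := by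
  have hiter : ∀ i ≤ K + L, u (j + i) = f^[i] (u j) := by
    intro i hi
    induction i with
    | zero => rfl
    | succ i ih =>
      rw [← add_assoc, hu i (by omega), ih (by omega), Function.iterate_succ_apply']
  obtain ⟨v, hv⟩ := hL (u j)
  refine ⟨(σ ^ K) v, fun n hn => ?_⟩
  have hsplit : j + (K + L) - n = j + ((K - n) + L) := by omega
  rw [hsplit, hiter _ (by omega), Function.iterate_add_apply, hv, iterate_inl hf,
    ← Equiv.Perm.mul_apply, ← zpow_natCast σ K, ← _root_.zpow_add, ← zpow_natCast]
  congr 3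
  omega

end Backbone

section ErrorBound

/-- The event that the last `K` states before time `k` run along the permutation and end in `x'`,
while the filter rates `x` at least as high as `x'`. -/
def confusionEvent {Ω : Type*} {m r S : ℕ} (X : ℕ → Ω → State m r) (Y : ℕ → Ω → Fin S)
    (σ : Equiv.Perm (Fin m)) (F : Matrix (Fin S) (Fin m) ℝ) (w0 : Fin m → ℝ) (δ : ℝ) (K k : ℕ)
    (x' x : Fin m) : Set Ω :=
  {ω | (∀ n < K, X (k - n) ω = Sum.inl ((σ ^ (-(n : ℤ))) x')) ∧
    recLogit σ F δ w0 (fun i => Y i ω) k x' ≤ recLogit σ F δ w0 (fun i => Y i ω) k x}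

/-- The factor of `exp (-lam / δ)` in the bound for the probability that the filter confuses some
pair of distinct states. -/
noncomputable def confusionConst {m S : ℕ} (σ : Equiv.Perm (Fin m))
    (F : Matrix (Fin S) (Fin m) ℝ) : ℝ :=
  ∑ p ∈ (Finset.univ : Finset (Fin m)).offDiag, Real.exp (-rateIntegral σ F p.1 p.2)

variable {Ω : Type*} {m r S : ℕ} {X : ℕ → Ω → State m r} {Y : ℕ → Ω → Fin S}
  {σ : Equiv.Perm (Fin m)} {D₁₂ : Matrix (Fin m) (Fin r) ℝ} {D₂₂ : Matrix (Fin r) (Fin r) ℝ}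
  {f : State m r → State m r} {E : Matrix (Fin S) (State m r) ℝ} {w0 : Fin m → ℝ}
  {lam α δ b : ℝ} {K L : ℕ}

lemma errorEvent_subset (hf : mapMatrix f = fromBlocks (permMat σ) D₁₂ 0 D₂₂)
    (hL : ∀ j, ∃ x, f^[L] j = Sum.inl x) (hE : ∀ s x, 0 < recEmission E s x) (hδ : δ < 1) (j : ℕ) :
    {ω | argmax (alf σ E δ w0 (fun i => Y i ω) (j + (K + L))) ≠ {X (j + (K + L)) ω}}
      ⊆ (⋃ i ∈ Finset.range (K + L), {ω | X (j + i + 1) ω ≠ f (X (j + i) ω)})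
        ∪ ⋃ p ∈ (Finset.univ : Finset (Fin m)).offDiag,
          confusionEvent X Y σ (recEmission E) w0 δ K (j + (K + L)) p.1 p.2 := by
  intro ω hω
  by_cases hjump : ∃ i < K + L, X (j + i + 1) ω ≠ f (X (j + i) ω)
  · obtain ⟨i, hi, hne⟩ := hjump
    exact Or.inl (Set.mem_biUnion (Finset.mem_range.2 hi) hne)
  · push Not at hjump
    obtain ⟨x', hx'⟩ := exists_recurrent_path hf hL (fun t => X t ω) hjump
    have hend : X (j + (K + L)) ω = Sum.inl x' := by simpa using hx' 0 (Nat.zero_le K)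
    rw [Set.mem_ofPred_eq, hend] at hω
    obtain ⟨x, hx, hle⟩ := exists_recLogit_le σ hE hδ hω
    exact Or.inr (Set.mem_biUnion (x := (x', x)) (by simpa using hx.symm)
      ⟨fun n hn => hx' n hn.le, hle⟩)

variable [MeasurableSpace Ω] {μ : Measure Ω} {π₀ : State m r → ℝ}
  {T : Matrix (State m r) (State m r) ℝ}

lemma IsColumnStochastic.sum_recEmission (hE : IsColumnStochastic E) (x : Fin m) :
    ∑ s, recEmission E s x = 1 :=
  hE.2 (Sum.inl x)

/-- Chernoff's bound at the point `1 / M`, the end point of the integrals defining `ξ`. -/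
lemma IsHMM.measureReal_confusionEvent_le_exp_sum (h : IsHMM μ X Y π₀ T E)
    (hE : IsColumnStochastic E) (hpos : ∀ s x, 0 < recEmission E s x) (hT : ∀ i j, T i j ≤ 1)
    (hδ0 : 0 < δ) (hδ1 : δ ≤ 1) {k : ℕ} (hK : K ≤ k) (x' x : Fin m) :
    μ.real (confusionEvent X Y σ (recEmission E) w0 δ K k x' x)
      ≤ Real.exp (∑ n ∈ Finset.range K,
            logMGF σ (recEmission E) x' x n (-(1 / (permOrder σ : ℝ)) * (1 - δ) ^ n)
          + 1 / (permOrder σ : ℝ)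
            * ((1 - δ) ^ K * (2 * logitBound (recEmission E) w0 / δ))) := by
  have := h.prob
  set F := recEmission E
  set c := 1 / (permOrder σ : ℝ)
  have hsub : confusionEvent X Y σ F w0 δ K k x' x
      ⊆ {ω | (∀ n < K, X (k - n) ω = Sum.inl ((σ ^ (-(n : ℤ))) x')) ∧
        ∑ n ∈ Finset.range K, c * ((1 - δ) ^ n * logRatio σ F x' x n (Y (k - n) ω))
          ≤ c * ((1 - δ) ^ K * (2 * logitBound F w0 / δ))} := by
    rintro ω ⟨hX, hle⟩
    refine ⟨hX, ?_⟩
    rw [← Finset.mul_sum]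
    exact mul_le_mul_of_nonneg_left (sum_logRatio_le_of_recLogit_le hpos hδ0 hδ1 hK hle)
      (by positivity)
  refine (measureReal_mono hsub (measure_ne_top _ _)).trans
    ((h.measureReal_window_le hE.1 hT hK (fun n => Sum.inl ((σ ^ (-(n : ℤ))) x'))
      (fun n s => c * ((1 - δ) ^ n * logRatio σ F x' x n s)) _).trans_eq ?_)
  rw [add_comm, Real.exp_add, Real.exp_sum]
  refine congr_arg _ (Finset.prod_congr rfl fun n _ => ?_)
  rw [exp_logMGF hpos hE.sum_recEmission]
  refine Finset.sum_congr rfl fun s _ => ?_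
  rw [neg_mul, neg_mul, mul_assoc]
  rfl

lemma IsHMM.measureReal_confusionEvent_le (h : IsHMM μ X Y π₀ T E)
    (hE : IsColumnStochastic E) (hpos : ∀ s x, 0 < recEmission E s x) (hT : ∀ i j, T i j ≤ 1)
    (hα : IsLargeWindow σ (recEmission E) w0 lam α) (hlam : 0 ≤ lam) (hδ0 : 0 < δ) (hδ1 : δ < 1)
    {k : ℕ} (hK : K ≤ k) (hαK : α / δ ≤ K) {x' x : Fin m} (hx : x ≠ x') :
    μ.real (confusionEvent X Y σ (recEmission E) w0 δ K k x' x)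
      ≤ Real.exp (-rateIntegral σ (recEmission E) x' x) * Real.exp (-lam / δ) := by
  refine (h.measureReal_confusionEvent_le_exp_sum hE hpos hT hδ0 hδ1.le hK x' x).trans ?_
  rw [← Real.exp_add, Real.exp_le_exp, neg_add_eq_sub]
  exact hα.sum_logMGF_add_le hpos hE.sum_recEmission hlam hx hδ0 hδ1 hαK

lemma IsHMM.errProb_le (h : IsHMM μ X Y π₀ T E) (hE : IsColumnStochastic E)
    (hpos : ∀ s x, 0 < recEmission E s x) (hT : ∀ i j, T i j ≤ 1)
    (hf : mapMatrix f = fromBlocks (permMat σ) D₁₂ 0 D₂₂) (hL : ∀ j, ∃ x, f^[L] j = Sum.inl x)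
    (hb : ∀ j, 1 - T (f j) j ≤ b) (hα : IsLargeWindow σ (recEmission E) w0 lam α)
    (hlam : 0 ≤ lam) (hδ0 : 0 < δ) (hδ1 : δ < 1) (hαK : α / δ ≤ K) {k : ℕ} (hk : K + L ≤ k) :
    errProb μ X Y σ E w0 δ k ≤ (K + L) * b
      + confusionConst σ (recEmission E) * Real.exp (-lam / δ) := by
  have := h.prob
  obtain ⟨j, rfl⟩ : ∃ j, k = j + (K + L) := ⟨k - (K + L), by omega⟩
  refine (measureReal_mono (errorEvent_subset hf hL hpos hδ1 j) (measure_ne_top _ _)).trans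
    ((measureReal_union_le _ _).trans (add_le_add ?_ ?_))
  · calc _ ≤ ∑ i ∈ Finset.range (K + L), μ.real {ω | X (j + i + 1) ω ≠ f (X (j + i) ω)} :=
          measureReal_biUnion_finset_le _ _
      _ ≤ ∑ _ ∈ Finset.range (K + L), b :=
          Finset.sum_le_sum fun _ _ => h.measureReal_jump_le hE.2 hb _
      _ = (K + L) * b := by simp
  · rw [confusionConst, Finset.sum_mul]
    refine (measureReal_biUnion_finset_le _ _).trans (Finset.sum_le_sum fun p hp => ?_)
    exact h.measureReal_confusionEvent_le hE hpos hT hα hlam hδ0 hδ1 (by omega) hαK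
      (Finset.mem_offDiag.1 hp).2.2.symm

lemma IsHMM.limsup_errProb_nonneg (h : IsHMM μ X Y π₀ T E) (w0 : Fin m → ℝ) (δ : ℝ) :
    0 ≤ limsup (errProb μ X Y σ E w0 δ) atTop := by
  have := h.prob
  exact le_limsup_of_frequently_le (Frequently.of_forall fun k => measureReal_nonneg)
    (isBoundedUnder_of ⟨1, fun k => measureReal_le_one⟩)

lemma IsHMM.limsup_errProb_le {Q : Matrix (State m r) (State m r) ℝ} {ε : ℝ}
    (h : IsHMM μ X Y π₀ (mapMatrix f + ε • Q) E) (hQ : IsDrift (mapMatrix f) Q)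
    (hE : IsColumnStochastic E) (hpos : ∀ s x, 0 < recEmission E s x)
    (hf : mapMatrix f = fromBlocks (permMat σ) D₁₂ 0 D₂₂) (hL : ∀ j, ∃ x, f^[L] j = Sum.inl x)
    (hα : IsLargeWindow σ (recEmission E) w0 lam α) (hlam : 0 ≤ lam) (hδ0 : 0 < δ) (hδ1 : δ < 1)
    (hε0 : 0 ≤ ε) (hε1 : -qMin (mapMatrix f) Q * ε ≤ 1) :
    limsup (errProb μ X Y σ E w0 δ) atTop
      ≤ (α / δ + (L + 1)) * (-qMin (mapMatrix f) Q * ε)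
        + confusionConst σ (recEmission E) * Real.exp (-lam / δ) := by
  have hjump := one_sub_transition_le f Q hε0
  have hb : 0 ≤ -qMin (mapMatrix f) Q * ε :=
    measureReal_nonneg.trans (h.measureReal_jump_le hE.2 hjump 0)
  have hceil := Nat.ceil_lt_add_one (div_pos hα.1 hδ0).le
  refine limsup_le_of_le (isCoboundedUnder_le_of_le atTop fun k => measureReal_nonneg) ?_
  filter_upwards [eventually_ge_atTop (⌈α / δ⌉₊ + L)] with k hk
  refine (h.errProb_le hE hpos (hQ.transition_le_one hε0 hε1) hf hL hjump hα hlam hδ0 hδ1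
    (Nat.le_ceil _) hk).trans (add_le_add_left (mul_le_mul_of_nonneg_right ?_ hb) _)
  linarith

end ErrorBound

section SmallNoise

lemma tendsto_log_one_div : Tendsto (fun ε : ℝ => Real.log (1 / ε)) (𝓝[>] 0) atTop := by
  simp only [one_div]
  exact Real.tendsto_log_atTop.comp tendsto_inv_nhdsGT_zero

lemma isLittleO_id_mul_log_one_div :
    (fun ε : ℝ => ε) =o[𝓝[>] 0] fun ε => ε * Real.log (1 / ε) := by
  have hone : (fun _ : ℝ => (1 : ℝ)) =o[𝓝[>] 0] fun ε => Real.log (1 / ε) :=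
    (Asymptotics.isLittleO_one_left_iff ℝ).2
      (tendsto_norm_atTop_atTop.comp tendsto_log_one_div)
  simpa using (Asymptotics.isBigO_refl (fun ε : ℝ => ε) (𝓝[>] 0)).mul_isLittleO hone

lemma tendsto_noise_add_exp {δ : ℝ → ℝ} (hδ0 : ∀ᶠ ε in 𝓝[>] (0 : ℝ), 0 < δ ε)
    (hδ : Tendsto δ (𝓝[>] 0) (𝓝 0)) (hεδ : Tendsto (fun ε => ε / δ ε) (𝓝[>] 0) (𝓝 0))
    (α L q C : ℝ) {lam : ℝ} (hlam : 0 < lam) :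
    Tendsto (fun ε => (α / δ ε + L) * (q * ε) + C * Real.exp (-lam / δ ε)) (𝓝[>] 0) (𝓝 0) := by
  have hε : Tendsto (fun ε : ℝ => ε) (𝓝[>] 0) (𝓝 0) := nhdsWithin_le_nhds
  have hinv : Tendsto (fun ε => (δ ε)⁻¹) (𝓝[>] 0) atTop :=
    tendsto_inv_nhdsGT_zero.comp (tendsto_nhdsWithin_iff.2 ⟨hδ, hδ0⟩)
  have hexp : Tendsto (fun ε => Real.exp (-lam / δ ε)) (𝓝[>] 0) (𝓝 0) :=
    Real.tendsto_exp_atBot.comp (hinv.const_mul_atTop_of_neg (neg_lt_zero.2 hlam))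
  have hsum := ((hεδ.const_mul (α * q)).add (hε.const_mul (L * q))).add (hexp.const_mul C)
  simp only [mul_zero, add_zero] at hsum
  exact hsum.congr fun ε => by ring

lemma exp_neg_div_div_log {lam ε : ℝ} (hlam : lam ≠ 0) (hε : 0 < ε) :
    Real.exp (-lam / (lam / Real.log (1 / ε))) = ε := by
  rw [neg_div, div_div_cancel₀ hlam, one_div, Real.log_inv, neg_neg, Real.exp_log hε]

variable {m r S : ℕ} {σ : Equiv.Perm (Fin m)} {D₁₂ : Matrix (Fin m) (Fin r) ℝ}
  {D₂₂ : Matrix (Fin r) (Fin r) ℝ} {f : State m r → State m r}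
  {Q : Matrix (State m r) (State m r) ℝ} {E : Matrix (Fin S) (State m r) ℝ} {w0 : Fin m → ℝ}
  {π₀ : State m r → ℝ} {Ω : ℝ → Type*} [∀ ε, MeasurableSpace (Ω ε)] {μ : ∀ ε, Measure (Ω ε)}
  {X : ∀ ε, ℕ → Ω ε → State m r} {Y : ∀ ε, ℕ → Ω ε → Fin S} {lam α : ℝ}

lemma exists_eventually_limsup_errProb_le
    (hf : mapMatrix f = fromBlocks (permMat σ) D₁₂ 0 D₂₂) (hD₂₂ : IsNilpotent D₂₂)
    (hQ : IsDrift (mapMatrix f) Q) (hE : IsColumnStochastic E)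
    (hpos : ∀ s x, 0 < recEmission E s x)
    (hHMM : ∀ᶠ ε in 𝓝[>] (0 : ℝ), IsHMM (μ ε) (X ε) (Y ε) π₀ (mapMatrix f + ε • Q) E)
    (hα : IsLargeWindow σ (recEmission E) w0 lam α) (hlam : 0 ≤ lam) :
    ∃ L C : ℝ, ∀ δ : ℝ → ℝ, (∀ᶠ ε in 𝓝[>] (0 : ℝ), 0 < δ ε) → Tendsto δ (𝓝[>] 0) (𝓝 0) →
      ∀ᶠ ε in 𝓝[>] (0 : ℝ), limsup (errProb (μ ε) (X ε) (Y ε) σ E w0 (δ ε)) atTop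
        ≤ (α / δ ε + L) * (-qMin (mapMatrix f) Q * ε) + C * Real.exp (-lam / δ ε) := by
  obtain ⟨L, hL⟩ := exists_iterate_eq_inl hf hD₂₂
  refine ⟨L + 1, confusionConst σ (recEmission E), fun δ hδ0 hδ => ?_⟩
  have hqε : Tendsto (fun ε => -qMin (mapMatrix f) Q * ε) (𝓝[>] 0) (𝓝 0) :=
    tendsto_nhdsWithin_of_tendsto_nhds (Continuous.tendsto' (by fun_prop) _ _ (mul_zero _))
  filter_upwards [hHMM, hδ0, hδ.eventually_lt_const one_pos, hqε.eventually_le_const one_pos,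
    self_mem_nhdsWithin] with ε h hδ0 hδ1 hε1 hε0
  exact h.limsup_errProb_le hQ hE hpos hf hL hα hlam hδ0 hδ1 (le_of_lt hε0) hε1

theorem tendsto_limsup_errProb
    (hf : mapMatrix f = fromBlocks (permMat σ) D₁₂ 0 D₂₂) (hD₂₂ : IsNilpotent D₂₂)
    (hQ : IsDrift (mapMatrix f) Q) (hE : IsColumnStochastic E)
    (hpos : ∀ s x, 0 < recEmission E s x) (hxi : 0 < xi σ (recEmission E))
    (hHMM : ∀ᶠ ε in 𝓝[>] (0 : ℝ), IsHMM (μ ε) (X ε) (Y ε) π₀ (mapMatrix f + ε • Q) E)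
    {δ : ℝ → ℝ} (hδ0 : ∀ᶠ ε in 𝓝[>] (0 : ℝ), 0 < δ ε) (hδ : Tendsto δ (𝓝[>] 0) (𝓝 0))
    (hεδ : Tendsto (fun ε => ε / δ ε) (𝓝[>] 0) (𝓝 0)) :
    Tendsto (fun ε => limsup (errProb (μ ε) (X ε) (Y ε) σ E w0 (δ ε)) atTop)
      (𝓝[>] 0) (𝓝 0) := by
  obtain ⟨lam, hlam, hlamxi⟩ := EReal.lt_iff_exists_real_btwn.1 hxi
  rw [EReal.coe_pos] at hlam
  obtain ⟨α, hα⟩ := exists_isLargeWindow w0 hlamxi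
  obtain ⟨L, C, hbound⟩ := exists_eventually_limsup_errProb_le hf hD₂₂ hQ hE hpos hHMM hα hlam.le
  exact tendsto_of_tendsto_of_tendsto_of_le_of_le' tendsto_const_nhds
    (tendsto_noise_add_exp hδ0 hδ hεδ α L _ C hlam)
    (hHMM.mono fun ε h => h.limsup_errProb_nonneg w0 (δ ε)) (hbound δ hδ0 hδ)

theorem exists_isLittleO_limsup_errProb_le
    (hf : mapMatrix f = fromBlocks (permMat σ) D₁₂ 0 D₂₂) (hD₂₂ : IsNilpotent D₂₂)
    (hQ : IsDrift (mapMatrix f) Q) (hE : IsColumnStochastic E)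
    (hpos : ∀ s x, 0 < recEmission E s x)
    (hHMM : ∀ᶠ ε in 𝓝[>] (0 : ℝ), IsHMM (μ ε) (X ε) (Y ε) π₀ (mapMatrix f + ε • Q) E)
    (hα : IsLargeWindow σ (recEmission E) w0 lam α) (hlam : 0 < lam) :
    ∃ R : ℝ → ℝ, R =o[𝓝[>] (0 : ℝ)] (fun ε => ε * Real.log (1 / ε)) ∧
      ∀ᶠ ε in 𝓝[>] (0 : ℝ),
        limsup (errProb (μ ε) (X ε) (Y ε) σ E w0 (lam / Real.log (1 / ε))) atTop
          ≤ kappa (mapMatrix f) Q lam α * (ε * Real.log (1 / ε)) + R ε := by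
  obtain ⟨L, C, hbound⟩ := exists_eventually_limsup_errProb_le hf hD₂₂ hQ hE hpos hHMM hα hlam.le
  refine ⟨fun ε => (L * -qMin (mapMatrix f) Q + C) * ε,
    isLittleO_id_mul_log_one_div.const_mul_left _, ?_⟩
  have hδ0 : ∀ᶠ ε in 𝓝[>] (0 : ℝ), 0 < lam / Real.log (1 / ε) :=
    (tendsto_log_one_div.eventually_gt_atTop 0).mono fun ε => div_pos hlam
  filter_upwards [hbound _ hδ0 (tendsto_log_one_div.const_div_atTop lam),
    self_mem_nhdsWithin] with ε hle hε
  rw [exp_neg_div_div_log hlam.ne' hε, div_div_eq_mul_div] at hle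
  exact hle.trans_eq (by rw [kappa]; ring)

end SmallNoise

end ALF

theorem theorem2 {m r S : ℕ}
    -- the deterministic backbone `D = [P, D₁₂; 0, D₂₂]` and the perturbation `Q`
    (σ : Equiv.Perm (Fin m)) (D₁₂ : Matrix (Fin m) (Fin r) ℝ) (D₂₂ : Matrix (Fin r) (Fin r) ℝ)
    (D Q : Matrix (ALF.State m r) (ALF.State m r) ℝ)
    (hD : D = Matrix.fromBlocks (ALF.permMat σ) D₁₂ 0 D₂₂)
    (hDdet : ALF.IsDeterministic D) (hD₂₂ : IsNilpotent D₂₂)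
    (hQ : ALF.IsDrift D Q)
    -- the emission matrix and the observability assumption
    (E : Matrix (Fin S) (ALF.State m r) ℝ) (hE : ALF.IsColumnStochastic E)
    (hEpos : ∀ s x, 0 < ALF.recEmission E s x)
    (hEs : ∀ x x' : Fin m, x ≠ x' →
      ∃ a, ALF.stacked σ (ALF.recEmission E) a x ≠ ALF.stacked σ (ALF.recEmission E) a x')
    -- the initial logits on the recurrent states
    (w0 : Fin m → ℝ)
    -- for every small `ε`, a hidden Markov model with transition matrix `D + ε Q`
    (π₀ : ALF.State m r → ℝ) (hπ₀ : (∀ x, 0 ≤ π₀ x) ∧ ∑ x, π₀ x = 1)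
    (Ω : ℝ → Type*) [∀ ε, MeasurableSpace (Ω ε)] (μ : ∀ ε, Measure (Ω ε))
    (X : ∀ ε, ℕ → Ω ε → ALF.State m r) (Y : ∀ ε, ℕ → Ω ε → Fin S)
    (hHMM : ∀ᶠ ε in 𝓝[>] (0 : ℝ), ALF.IsHMM (μ ε) (X ε) (Y ε) π₀ (D + ε • Q) E) :
    (∀ δ : ℝ → ℝ, (∀ᶠ ε in 𝓝[>] (0 : ℝ), 0 < δ ε) →
      Tendsto δ (𝓝[>] 0) (𝓝 0) → Tendsto (fun ε => ε / δ ε) (𝓝[>] 0) (𝓝 0) →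
      Tendsto (fun ε => limsup (ALF.errProb (μ ε) (X ε) (Y ε) σ E w0 (δ ε)) atTop)
        (𝓝[>] 0) (𝓝 0)) ∧
    0 < ALF.xi σ (ALF.recEmission E) ∧
    ∀ lam : ℝ, 0 < lam → (lam : EReal) < ALF.xi σ (ALF.recEmission E) →
      (∃ α, ALF.IsLargeWindow σ (ALF.recEmission E) w0 lam α) ∧
      ∀ α, ALF.IsLargeWindow σ (ALF.recEmission E) w0 lam α →
        (Q ≠ 0 → 0 < ALF.kappa D Q lam α) ∧
        ∃ R : ℝ → ℝ,
          R =o[𝓝[>] (0 : ℝ)] (fun ε => ε * Real.log (1 / ε)) ∧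
          ∀ᶠ ε in 𝓝[>] (0 : ℝ),
            limsup (ALF.errProb (μ ε) (X ε) (Y ε) σ E w0 (lam / Real.log (1 / ε))) atTop
              ≤ ALF.kappa D Q lam α * (ε * Real.log (1 / ε)) + R ε := by
  obtain ⟨f, rfl⟩ := hDdet.exists_eq_mapMatrix
  have hxi := ALF.xi_pos hEpos hE.sum_recEmission hEs
  refine ⟨fun δ hδ0 hδ hεδ =>
    ALF.tendsto_limsup_errProb hD hD₂₂ hQ hE hEpos hxi hHMM hδ0 hδ hεδ, hxi, ?_⟩
  refine fun lam hlam hlamxi => ⟨ALF.exists_isLargeWindow w0 hlamxi, fun α hα => ⟨fun hQ0 => ?_,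
    ALF.exists_isLittleO_limsup_errProb_le hD hD₂₂ hQ hE hEpos hHMM hα hlam⟩⟩
  exact div_pos (mul_pos (neg_pos.2 (hQ.qMin_neg hQ0)) hα.1) hlam
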